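/- Let $k\ge 1$ and let $\alpha=(\alpha_1,\dots,\alpha_k)\in\mathbb N^k$ be nonzero. For a field $\mathbb K$ and $n\ge k$ let $\langle n\rangle^k$ be the set of $k$-tuples of pairwise distinct elements of $[n]=\{1,\dots,n\}$, let $R_n=\mathbb K[x_u : u\in\langle n\rangle^k]$, let $I_n$ be the kernel of the homomorphism $\phi_n:R_n\to\mathbb K[t_1,\dots,t_n]$, $x_u\mapsto t_{u_1}^{\alpha_1}\cdots t_{u_k}^{\alpha_k}$, and let $I_n^{\pm}$ be the ideal generated by $I_n$ in the Laurent polynomial ring $R_n^{\pm}=\mathbb K[x_u^{\pm1} : u\in\langle n\rangle^k]$. The symmetric group $\mathfrak S_n$ acts on $R_n^\pm$ by $\sigma x_u=x_{(\sigma(u_1),\dots,\sigma(u_k))}$. Put $\alpha'=\alpha/\gcd(\alpha_1,\dots,\alpha_k)$, $d=|\alpha'|=\alpha'_1+\cdots+\alpha'_k$, $r=\max_i\alpha'_i$ and $N=\max(2d,k+1)$; thus $N=2d$ if all $\alpha_i$ are positive. Let $$\mathcal B_N=\{a\in\mathbb Z^N : a_1+\cdots+a_N=d,\ 0\le a_j\le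 r\},$$ and let $I_{\mathcal B_N}$ be its toric ideal, i.e. the kernel of $\mathbb K[x_a : a\in\mathcal B_N]\to\mathbb K[t_1,\dots,t_N]$, $x_a\mapsto t_1^{a_1}\cdots t_N^{a_N}$. There is an algorithm (given by computable functions of $\alpha$, independent of $\mathbb K$) which, for every nonzero $\alpha$ of any length $k$, computes finite lists $\mathcal G$ and $G$ with the following properties. 1. $\mathcal G$ consists of quadratic binomials $x_ax_b-x_{a'}x_{b'}$ and, over every field $\mathbb K$, is the reduced Gröbner basis of $I_{\mathcal B_N}$ for a monomial order that does not depend on $\mathbb K$. 2. $G$ consists of the images of the elements of $\mathcal G$ under the replacement $x_a\mapsto\mu(x_a)\in R_N^\pm$ described below, together with all linear binomials $x_u-x_v$ with $u\ne v$ in $\langle N\rangle^k$ and $\phi_N(x_u)=\phi_N(x_v)$ (there are none if the $\alpha_i$ are positive and pairwise distinct). For a permutation $v=\sigma(\alpha'_1,\dots,\alpha'_k,0,\dots,0)\in\mathbb Z^N$ with $\sigma\in\mathfrak S_N$ write $x_{\sigma\alpha'}$ for the indeterminate $x_{(\sigma(1),\dots,\sigma(k))}$ of $R_N$. If $a\in\mathcal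 B_N$ is such a permutation, then $\mu(x_a)$ is an indeterminate $x_u$ of $R_N$ such that $a$ is the vector having entry $\alpha'_i$ in position $u_i$ for each $i$ and zeros elsewhere. For every other $a$ it is the monomial quotient $$\mu(x_a)=x_{\alpha'}^{\,q}\ \prod_{j=1}^{N-1}\prod_{i=1}^k\left(\frac{x_{\sigma_{ij}\alpha'}}{x_{\tau_j\sigma_{ij}\alpha'}}\right)^{(a_j-q\alpha'_j)b_i},\qquad q=\frac{|a|}{|\alpha'|}=1,$$ where $\alpha'_j=0$ for $j>k$, where $\sigma_{ij}=(i\;j)$ and $\tau_j=(j\;N)$ are transpositions (the identity if the two entries agree), and where $b_1,\dots,b_k$ are integers, the same for all $a$, with $b_1\alpha'_1+\cdots+b_k\alpha'_k=1$. 3. $G$ is a finite generating set of the Laurent chain: for every field $\mathbb K$, the set $G$ generates the ideal $I_N^\pm$ of $R_N^\pm$, and for every $m\ge N$ the set $\mathfrak S_mG=\{\sigma g:\sigma\in\mathfrak S_m,\ g\in G\}$ generates the ideal $I_m^\pm$ of $R_m^\pm$. -/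

import Mathlib

universe u

namespace LaurentChain

/-! ### Chains of ideals induced by a polynomial

`Fin k ↪ Fin n` is the set of `k`-tuples of pairwise distinct elements of an `n`-element set, and
`MvPolynomial (Fin k ↪ Fin n) K` is the polynomial ring in the indeterminates indexed by it. -/

section Chain

variable {K : Type*} [Field K] {k : ℕ}

/-- The map `x_u ↦ f(t_{u_1}, …, t_{u_k})`. -/
noncomputable def inducedMap (f : MvPolynomial (Fin k) K) (n : ℕ) :
    MvPolynomial (Fin k ↪ Fin n) K →ₐ[K] MvPolynomial (Fin n) K :=
  MvPolynomial.aeval fun u => MvPolynomial.aeval (fun i => MvPolynomial.X (u i)) f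

/-- The `n`-th ideal of the chain induced by `f`. -/
noncomputable def inducedIdeal (f : MvPolynomial (Fin k) K) (n : ℕ) :
    Ideal (MvPolynomial (Fin k ↪ Fin n) K) :=
  RingHom.ker (inducedMap f n)

/-- The ring of Laurent polynomials over `K` in the indeterminates `x_u`, `u : Fin k ↪ Fin n`. -/
abbrev LaurentRing (K : Type*) [Field K] (k n : ℕ) : Type _ :=
  AddMonoidAlgebra K ((Fin k ↪ Fin n) →₀ ℤ)

/-- The Laurent monomial with a given exponent vector. -/
noncomputable def laurentMonomial (K : Type*) [Field K] {k n : ℕ}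
    (e : (Fin k ↪ Fin n) →₀ ℤ) : LaurentRing K k n :=
  AddMonoidAlgebra.single e 1

/-- The inclusion of the polynomial ring into the Laurent polynomial ring. -/
noncomputable def toLaurent (K : Type*) [Field K] (k n : ℕ) :
    MvPolynomial (Fin k ↪ Fin n) K →ₐ[K] LaurentRing K k n :=
  MvPolynomial.aeval fun u => laurentMonomial K (Finsupp.single u 1)

/-- The `n`-th Laurent ideal of the chain induced by `f`: the extension of `inducedIdeal f n`. -/
noncomputable def laurentIdeal (f : MvPolynomial (Fin k) K) (n : ℕ) : Ideal (LaurentRing K k n) :=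
  (inducedIdeal f n).map (toLaurent K k n)

/-- The map `x_u ↦ x_{e ∘ u}` of Laurent polynomial rings. For a permutation `e` this is the
action of the symmetric group, for an initial segment inclusion it is the inclusion of rings. -/
noncomputable def laurentRename (K : Type*) [Field K] (k : ℕ) {n m : ℕ} (e : Fin n ↪ Fin m) :
    LaurentRing K k n →ₐ[K] LaurentRing K k m :=
  AddMonoidAlgebra.mapDomainAlgHom K K
    (Finsupp.mapDomain.addMonoidHom fun u : Fin k ↪ Fin n => u.trans e)

/-- `σ g` for all `g ∈ G` and all permutations `σ` of the `m` indices. -/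
def translates {n m : ℕ} (h : n ≤ m) (G : Set (LaurentRing K k n)) : Set (LaurentRing K k m) :=
  {p | ∃ σ : Equiv.Perm (Fin m), ∃ g ∈ G,
    p = laurentRename K k σ.toEmbedding (laurentRename K k (Fin.castLEEmb h) g)}

/-- `G` generates the `N`-th Laurent ideal, and its translates under the symmetric group generate
all later Laurent ideals of the chain. -/
def GeneratesLaurentChain (f : MvPolynomial (Fin k) K) (N : ℕ) (G : Set (LaurentRing K k N)) :
    Prop :=
  Ideal.span G = laurentIdeal f N ∧
    ∀ (m : ℕ) (h : N ≤ m), Ideal.span (translates h G) = laurentIdeal f m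

end Chain

/-! ### The toric ideal of all bounded exponent vectors of fixed degree -/

section Veronese

variable {k : ℕ}

/-- The exponent vector divided by the greatest common divisor of its entries. -/
def primitivePart (α : Fin k → ℕ) (i : Fin k) : ℕ := α i / Finset.univ.gcd α

/-- The number of indices used: `max (2 d) (k + 1)`, with `d` the degree of the primitive part.
It equals `2 d` if all entries of a nonzero `α` are positive, since then `1 ≤ k ≤ d`. -/
def bound (α : Fin k → ℕ) : ℕ := max (2 * ∑ i, primitivePart α i) (k + 1)

/-- The set of vectors `a ∈ ℤ^n` with `0 ≤ a_j ≤ max α` for all `j` and `∑ a_j = ∑ α_i`. -/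
abbrev VeroneseIndex (α : Fin k → ℕ) (n : ℕ) : Type :=
  {a : Fin n → Fin (Finset.univ.sup α + 1) // ∑ j, (a j : ℕ) = ∑ i, α i}

/-- The entries of an element of `VeroneseIndex α n`. -/
def VeroneseIndex.entries {α : Fin k → ℕ} {n : ℕ} (a : VeroneseIndex α n) (j : Fin n) : ℕ :=
  (a.1 j : ℕ)

/-- The toric map `x_a ↦ ∏ t_j ^ a_j`. -/
noncomputable def veroneseMap (K : Type*) [Field K] (α : Fin k → ℕ) (n : ℕ) :
    MvPolynomial (VeroneseIndex α n) K →ₐ[K] MvPolynomial (Fin n) K :=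
  MvPolynomial.aeval fun a => ∏ j, MvPolynomial.X j ^ a.entries j

/-- The toric ideal of `VeroneseIndex α n`. -/
noncomputable def veroneseIdeal (K : Type*) [Field K] (α : Fin k → ℕ) (n : ℕ) :
    Ideal (MvPolynomial (VeroneseIndex α n) K) :=
  RingHom.ker (veroneseMap K α n)

/-- `G` is the reduced Gröbner basis of the ideal `I` for the monomial order `ord`. -/
structure IsReducedGroebnerBasis {σ K : Type*} [Field K] (ord : MonomialOrder σ)
    (I : Ideal (MvPolynomial σ K)) (G : Set (MvPolynomial σ K)) : Prop where
  subset : G ⊆ I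
  span_leadingTerm :
    Ideal.span (ord.leadingTerm '' G) = Ideal.span (ord.leadingTerm '' (I : Set (MvPolynomial σ K)))
  monic : ∀ g ∈ G, ord.leadingCoeff g = 1
  reduced : ∀ g ∈ G, ∀ h ∈ G, h ≠ g → ∀ e ∈ g.support, ¬ ord.degree h ≤ e

end Veronese

/-! ### The integer decomposition and the monomial quotients -/

section Decomposition

variable {k n : ℕ}

/-- The exponent vector of the image `∏ t_{u_i} ^ α_i` of `x_u`. -/
def exponentVector (α : Fin k → ℕ) (u : Fin k ↪ Fin n) (j : Fin n) : ℕ :=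
  ∑ i, if u i = j then α i else 0

/-- `σ (1, …, k)`, so that `x_{permTuple h σ}` has image with exponent vector
`σ (α_1, …, α_k, 0, …, 0)`. -/
def permTuple (h : k < n) (σ : Equiv.Perm (Fin n)) : Fin k ↪ Fin n :=
  (Fin.castLEEmb h.le).trans σ.toEmbedding

/-- The explicit integer decomposition of a vector `β` whose entries sum to a multiple of `∑ α_i`.
With integers `b_i` satisfying `∑ b_i α_i = 1`, with `q = |β| / |α|` and with the transpositions
`σ_ij = (i j)` and `τ_j = (j n)` it reads
`β = q α + ∑_{j < n} ∑_i (β_j - q α_j) b_i (σ_ij α - τ_j σ_ij α)`.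
The definition records the coefficients, where the vector `σ α` is represented by the tuple
`σ (1, …, k)`. -/
noncomputable def decomposition (h : k < n) (α : Fin k → ℕ) (b : Fin k → ℤ) (β : Fin n → ℤ) :
    (Fin k ↪ Fin n) →₀ ℤ :=
  let last : Fin n := ⟨n - 1, by omega⟩
  let q : ℤ := (∑ j, β j) / (∑ i, (α i : ℤ))
  let α₀ : Fin n → ℤ := fun j => if hj : (j : ℕ) < k then (α ⟨j, hj⟩ : ℤ) else 0
  let s : Fin k → Fin n → Equiv.Perm (Fin n) := fun i j => Equiv.swap (Fin.castLE h.le i) j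
  q • Finsupp.single (permTuple h 1) 1 +
    ∑ j ∈ Finset.univ.erase last, ∑ i, ((β j - q * α₀ j) * b i) •
      (Finsupp.single (permTuple h (s i j)) 1 -
        Finsupp.single (permTuple h (Equiv.swap j last * s i j)) 1)

/-- `μ a` is the exponent vector of the Laurent monomial which replaces the indeterminate `x_a`:
if `a` is a permutation of `α` (padded by zeros), `x_a` is identified with an indeterminate `x_u`
which has the same image; otherwise it is replaced by the monomial quotient given by the explicit
decomposition of `a` with coefficients `b`. -/
def IsReplacement (h : k < n) (α : Fin k → ℕ) (b : Fin k → ℤ)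
    (μ : VeroneseIndex α n → ((Fin k ↪ Fin n) →₀ ℤ)) : Prop :=
  ∀ a : VeroneseIndex α n,
    (∃ u, exponentVector α u = a.entries ∧ μ a = Finsupp.single u 1) ∨
    ((∀ u : Fin k ↪ Fin n, exponentVector α u ≠ a.entries) ∧
      μ a = decomposition h α b fun j => (a.entries j : ℤ))

/-- The algebra homomorphism which replaces every `x_a` by the Laurent monomial of `μ a`. -/
noncomputable def replace (K : Type*) [Field K] {α : Fin k → ℕ}
    (μ : VeroneseIndex α n → ((Fin k ↪ Fin n) →₀ ℤ)) :
    MvPolynomial (VeroneseIndex α n) K →ₐ[K] LaurentRing K k n :=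
  MvPolynomial.aeval fun a => laurentMonomial K (μ a)

/-- The linear binomials `x_u - x_v` with `u ≠ v` for which `x_u` and `x_v` have the same image.
There are none if the entries of `α` are positive and pairwise distinct. -/
def linearBinomials (K : Type*) [Field K] (α : Fin k → ℕ) (n : ℕ) : Set (LaurentRing K k n) :=
  {p | ∃ u v : Fin k ↪ Fin n, u ≠ v ∧ exponentVector α u = exponentVector α v ∧
    p = laurentMonomial K (Finsupp.single u 1) - laurentMonomial K (Finsupp.single v 1)}

end Decomposition

/-! ### Codes for inputs and outputs of algorithms

An indeterminate is coded by the list of the entries of its index, a monomial by a list of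
indeterminates (repeated according to multiplicity), a monomial quotient by a numerator and a
denominator, and a binomial by the pair of its terms. -/

section Codes

/-- Codes of monomials. -/
abbrev MonomialCode : Type := List (List ℕ)

/-- Codes of monomial quotients (numerator, denominator). -/
abbrev QuotientCode : Type := MonomialCode × MonomialCode

/-- The code of the index `a` of an indeterminate `x_a`. -/
def veroneseCode {k : ℕ} (α : Fin k → ℕ) (n : ℕ) (a : VeroneseIndex α n) : List ℕ :=
  List.ofFn a.entries

/-- The code of the index `u` of an indeterminate `x_u`. -/
def tupleCode (k n : ℕ) (u : Fin k ↪ Fin n) : List ℕ :=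
  List.ofFn fun i => (u i : ℕ)

/-- All entries of the monomial code `c` are codes of indeterminates. -/
def IsMonomialCode {ι : Type} (code : ι → List ℕ) (c : MonomialCode) : Prop :=
  ∀ w ∈ c, w ∈ Set.range code

/-- The exponent vector of the monomial coded by `c`. -/
noncomputable def exponentOf {ι : Type} [Finite ι] (code : ι → List ℕ) (c : MonomialCode) :
    ι →₀ ℕ :=
  Finsupp.equivFunOnFinite.symm fun i => c.count (code i)

/-- The binomials coded by the entries of `l`. -/
noncomputable def decodeBinomials (K : Type*) [Field K] {k : ℕ} (α : Fin k → ℕ) (n : ℕ)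
    (l : List (MonomialCode × MonomialCode)) : Set (MvPolynomial (VeroneseIndex α n) K) :=
  {p | ∃ c ∈ l, p = MvPolynomial.monomial (exponentOf (veroneseCode α n) c.1) 1 -
    MvPolynomial.monomial (exponentOf (veroneseCode α n) c.2) 1}

/-- The Laurent monomial coded by `c`. -/
noncomputable def decodeQuotient (K : Type*) [Field K] (k n : ℕ) (c : QuotientCode) :
    LaurentRing K k n :=
  laurentMonomial K
    ((exponentOf (tupleCode k n) c.1).mapRange (Nat.cast : ℕ → ℤ) Nat.cast_zero -
      (exponentOf (tupleCode k n) c.2).mapRange (Nat.cast : ℕ → ℤ) Nat.cast_zero)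

/-- The Laurent binomials coded by the entries of `l`. -/
noncomputable def decodeLaurentBinomials (K : Type*) [Field K] (k n : ℕ)
    (l : List (QuotientCode × QuotientCode)) : Set (LaurentRing K k n) :=
  {p | ∃ c ∈ l, p = decodeQuotient K k n c.1 - decodeQuotient K k n c.2}

end Codes

/-- `B` codes the reduced Gröbner basis, for some monomial order which does not depend on the
field, of the toric ideal of `VeroneseIndex α n`, and it consists of quadratic binomials. -/
def IsQuadraticGroebnerCode {k : ℕ} (α : Fin k → ℕ) (n : ℕ)
    (B : List (MonomialCode × MonomialCode)) : Prop :=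
  (∀ c ∈ B, IsMonomialCode (veroneseCode α n) c.1 ∧ IsMonomialCode (veroneseCode α n) c.2 ∧
    c.1.length = 2 ∧ c.2.length = 2) ∧
  ∃ ord : MonomialOrder.{0, 0} (VeroneseIndex α n), ∀ (K : Type u) [Field K],
    IsReducedGroebnerBasis ord (veroneseIdeal K α n) (decodeBinomials K α n B)

/-- `G` codes the Laurent binomials which arise from the binomials coded by `B` by replacing the
indeterminates by monomial quotients, together with the linear binomials. -/
def IsReplacementCode {k n : ℕ} (h : k < n) (α : Fin k → ℕ)
    (B : List (MonomialCode × MonomialCode)) (G : List (QuotientCode × QuotientCode)) : Prop :=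
  (∀ c ∈ G, ∀ e ∈ [c.1.1, c.1.2, c.2.1, c.2.2], IsMonomialCode (tupleCode k n) e) ∧
  ∃ (b : Fin k → ℤ) (μ : VeroneseIndex α n → ((Fin k ↪ Fin n) →₀ ℤ)),
    ∑ i, b i * (α i : ℤ) = 1 ∧ IsReplacement h α b μ ∧
    ∀ (K : Type u) [Field K], decodeLaurentBinomials K k n G =
      replace K μ '' decodeBinomials K α n B ∪ linearBinomials K α n

theorem lt_bound {k : ℕ} (α : Fin k → ℕ) : k < bound α :=
  lt_of_lt_of_le (Nat.lt_succ_self k) (le_max_right _ _)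

end LaurentChain

/-! The argument has two ingredients: Sturmfels' sorting algorithm for the toric ideal of
`VeroneseIndex`, and the fact that a Laurent ideal of monomial relations is controlled by a lattice.

Sorting. Encode an index by its partial sums. A pair `a, b` is replaced by the pair whose partial
sums are the rounded up and rounded down averages, `upper a b` and `lower a b`. This keeps the
product of the images, respects the bound on the entries, and strictly lowers a convex weight unless
the pair is already sorted (`VeroneseIndex.weight_lt`). So every monomial can be sorted in finitely
many steps. A sorted monomial is determined by its image, because the partial sums of its largest
variable are rounded up averages that can be read off from the image
(`IsSorted.eq_of_toricExponent_eq`). Hence sorted monomials are the standard monomials for an order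
that compares weights first, and the sorting relations form the reduced Gröbner basis over every
field (`isReducedGroebnerBasis_sortingBinomials`).

Lattices. In the Laurent ring monomials are units, so a binomial lies in an ideal exactly when the
difference of its exponents lies in a subgroup (`unitLattice`). The Laurent ideal of the chain is
the smallest ideal whose subgroup contains the kernel of `tupleExponent`
(`ker_le_unitLattice_laurentIdeal`, `laurentIdeal_le`). Dividing `α` by its gcd does not change this
kernel.

Generation at `N`. A Bézout relation for the primitive part makes every difference of unit vectors
an image, which yields the explicit decomposition and thus a lift of every index to a Laurent
monomial. Given such a lift, the kernel is generated by the lifted sorting relations and by the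
comparison of each `x_u` with the lift of its own index (`mem_of_tupleExponent_eq_zero`); the latter
are the linear binomials.

Stabilization. For `m ≥ N` each index is lifted using tuples with entries in some `N`-set containing
its support. An exchange argument shows that the choice is irrelevant modulo relations living on
`N`-sets (`sub_mem_of_supportedOn`). A sorting relation is quadratic, so it involves at most `2d`
positions and fits in one `N`-set (`mem_of_forall_supportedOn`). Every `N`-set is a translate of the
initial one, so translates of generators at level `N` suffice.

Computability. All constructions are primitive recursive on lists, except for the Bézout
coefficients, which are found by an unbounded search that always terminates. -/

namespace LaurentChain

/-! ### Sorting pairs of exponent vectors; sorted monomials as normal forms. -/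

section Sorting

variable {k n : ℕ} {α : Fin k → ℕ}

namespace VeroneseIndex

/-- The entries, extended by zero to all natural numbers. -/
def extend (a : VeroneseIndex α n) (i : ℕ) : ℕ := if h : i < n then a.entries ⟨i, h⟩ else 0

/-- The sum of the first `j` entries. -/
def cum (a : VeroneseIndex α n) (j : ℕ) : ℕ := ∑ i ∈ Finset.range j, a.extend i

theorem entries_injective : Function.Injective (entries : VeroneseIndex α n → Fin n → ℕ) := by
  intro a b h
  apply Subtype.ext
  funext j
  exact Fin.ext (congrFun h j)

theorem sum_entries (a : VeroneseIndex α n) : ∑ j, a.entries j = ∑ i, α i := a.2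

theorem entries_le (a : VeroneseIndex α n) (j : Fin n) : a.entries j ≤ Finset.univ.sup α :=
  Nat.le_of_lt_succ (a.1 j).2

theorem extend_val (a : VeroneseIndex α n) (j : Fin n) : a.extend j = a.entries j := by
  simp [extend]

theorem extend_le (a : VeroneseIndex α n) (i : ℕ) : a.extend i ≤ Finset.univ.sup α := by
  unfold extend
  split_ifs
  · exact a.entries_le _
  · exact Nat.zero_le _

@[simp]
theorem cum_zero (a : VeroneseIndex α n) : a.cum 0 = 0 := by simp [cum]

theorem cum_succ (a : VeroneseIndex α n) (j : ℕ) : a.cum (j + 1) = a.cum j + a.extend j := by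
  simp [cum, Finset.sum_range_succ]

theorem cum_last (a : VeroneseIndex α n) : a.cum n = ∑ i, α i := by
  rw [cum, Finset.sum_range, ← a.sum_entries]
  exact Finset.sum_congr rfl fun j _ => a.extend_val j

theorem ext_cum {a b : VeroneseIndex α n} (h : ∀ j ≤ n, a.cum j = b.cum j) : a = b := by
  apply entries_injective
  funext j
  have h1 := h j j.2.le
  have h2 := h (j + 1) j.2
  rw [cum_succ, cum_succ, h1] at h2
  simpa [extend_val] using h2

/-- The index with given bounded entries of the right sum. -/
def ofFun (x : ℕ → ℕ) (hx : ∀ i, x i ≤ Finset.univ.sup α)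
    (hs : ∑ i ∈ Finset.range n, x i = ∑ i, α i) : VeroneseIndex α n :=
  ⟨fun i => ⟨x i, Nat.lt_succ_of_le (hx i)⟩, by rw [← hs, Finset.sum_range]⟩

theorem extend_ofFun {x : ℕ → ℕ} (hx : ∀ i, x i ≤ Finset.univ.sup α)
    (hs : ∑ i ∈ Finset.range n, x i = ∑ i, α i) {i : ℕ} (hi : i < n) :
    (ofFun x hx hs : VeroneseIndex α n).extend i = x i := by
  simp [extend, hi, ofFun, entries]

theorem cum_ofFun {F : ℕ → ℕ} (hF : Monotone F) (hx : ∀ i, F (i + 1) - F i ≤ Finset.univ.sup α)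
    (hs : ∑ i ∈ Finset.range n, (F (i + 1) - F i) = ∑ i, α i) {j : ℕ} (hj : j ≤ n) :
    (ofFun (fun i => F (i + 1) - F i) hx hs : VeroneseIndex α n).cum j = F j - F 0 := by
  rw [← Finset.sum_range_tsub hF, cum]
  refine Finset.sum_congr rfl fun i hi => extend_ofFun _ _ ?_
  exact (Finset.mem_range.1 hi).trans_le hj

theorem cum_mono (a : VeroneseIndex α n) : Monotone a.cum :=
  monotone_nat_of_le_succ fun j => by rw [cum_succ]; exact Nat.le_add_right _ _

/-- The first half of the sorting of a pair: its partial sums are the rounded up averages. -/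
def upper (a b : VeroneseIndex α n) : VeroneseIndex α n :=
  ofFun (fun i => (a.cum (i + 1) + b.cum (i + 1) + 1) / 2 - (a.cum i + b.cum i + 1) / 2)
    -- The averaged sum grows by at most `2 * sup α` before halving, so rounding cannot push an
    -- entry above `sup α`.
    (fun i => by
      have := a.extend_le i
      have := b.extend_le i
      rw [cum_succ, cum_succ]
      omega)
    (by
      rw [Finset.sum_range_tsub (f := fun i => (a.cum i + b.cum i + 1) / 2), cum_last, cum_last]
      · simp only [cum_zero]
        omega
      · intro i j hij
        have := a.cum_mono hij
        have := b.cum_mono hij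
        dsimp only
        omega)

/-- The second half of the sorting of a pair: its partial sums are the rounded down averages. -/
def lower (a b : VeroneseIndex α n) : VeroneseIndex α n :=
  ofFun (fun i => (a.cum (i + 1) + b.cum (i + 1)) / 2 - (a.cum i + b.cum i) / 2)
    (fun i => by
      have := a.extend_le i
      have := b.extend_le i
      rw [cum_succ, cum_succ]
      omega)
    (by
      rw [Finset.sum_range_tsub (f := fun i => (a.cum i + b.cum i) / 2), cum_last, cum_last]
      · simp only [cum_zero]
        omega
      · intro i j hij
        have := a.cum_mono hij
        have := b.cum_mono hij
        dsimp only
        omega)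

theorem cum_upper (a b : VeroneseIndex α n) {j : ℕ} (hj : j ≤ n) :
    (upper a b).cum j = (a.cum j + b.cum j + 1) / 2 := by
  rw [upper, cum_ofFun (F := fun i => (a.cum i + b.cum i + 1) / 2) _ _ _ hj]
  · simp
  · intro i j hij
    have := a.cum_mono hij
    have := b.cum_mono hij
    dsimp only
    omega

theorem cum_lower (a b : VeroneseIndex α n) {j : ℕ} (hj : j ≤ n) :
    (lower a b).cum j = (a.cum j + b.cum j) / 2 := by
  rw [lower, cum_ofFun (F := fun i => (a.cum i + b.cum i) / 2) _ _ _ hj]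
  · simp
  · intro i j hij
    have := a.cum_mono hij
    have := b.cum_mono hij
    dsimp only
    omega

theorem upper_comm (a b : VeroneseIndex α n) : upper a b = upper b a :=
  ext_cum fun j hj => by rw [cum_upper _ _ hj, cum_upper _ _ hj, add_comm (a.cum j)]

theorem lower_comm (a b : VeroneseIndex α n) : lower a b = lower b a :=
  ext_cum fun j hj => by rw [cum_lower _ _ hj, cum_lower _ _ hj, add_comm (a.cum j)]

theorem upper_self (a : VeroneseIndex α n) : upper a a = a :=
  ext_cum fun j hj => by rw [cum_upper _ _ hj]; omega

/-- A sorted pair is fixed by sorting; this is what keeps trailing terms of sorting relations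
irreducible. -/
theorem upper_upper_lower (a b : VeroneseIndex α n) : upper (upper a b) (lower a b) = upper a b :=
  ext_cum fun j hj => by
    rw [cum_upper _ _ hj, cum_upper _ _ hj, cum_lower _ _ hj]
    omega

/-- The two roundings of half an integer add up to that integer, so total partial sums are
preserved, and with them their increments. This puts sorting relations in the toric ideal. -/
theorem entries_upper_add_lower (a b : VeroneseIndex α n) (j : Fin n) :
    (upper a b).entries j + (lower a b).entries j = a.entries j + b.entries j := by
  simp only [← extend_val]
  have h1 := cum_succ (upper a b) j
  have h2 := cum_succ (lower a b) j
  have h3 := cum_succ a j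
  have h4 := cum_succ b j
  rw [cum_upper _ _ (Nat.succ_le_of_lt j.2), cum_upper _ _ j.2.le, Nat.succ_eq_add_one] at h1
  rw [cum_lower _ _ (Nat.succ_le_of_lt j.2), cum_lower _ _ j.2.le, Nat.succ_eq_add_one] at h2
  omega

/-- A strictly convex weight, which decreases under sorting. -/
def weight (a : VeroneseIndex α n) : ℕ :=
  ∑ p ∈ Finset.range (n + 1) ×ˢ Finset.range (n + 1),
    ((a.cum p.1 : ℤ) - (a.cum p.2 : ℤ)).natAbs ^ 2

end VeroneseIndex

theorem sq_add_sq_eq (X Y : ℤ) : 2 * (X ^ 2 + Y ^ 2) = (X + Y) ^ 2 + (X - Y) ^ 2 := by ring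

/-- For a fixed sum, the sum of squares is governed by the square of the difference, and the parity
of the difference is fixed by the sum. A splitting with difference at most one in absolute value is
therefore optimal. -/
theorem sq_add_sq_le_of_balanced {X Y U L : ℤ} (h : X + Y = U + L) (h1 : U - L ≤ 1)
    (h2 : -1 ≤ U - L) : U ^ 2 + L ^ 2 ≤ X ^ 2 + Y ^ 2 := by
  have e1 := sq_add_sq_eq X Y
  have e2 := sq_add_sq_eq U L
  rw [h] at e1
  by_cases h0 : U - L = 0
  · rw [h0] at e2
    linarith [sq_nonneg (X - Y)]
  · have : X - Y ≠ 0 := by omega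
    have := sq_pos_of_ne_zero this
    have : (U - L) ^ 2 ≤ 1 := by nlinarith
    omega

theorem sq_add_sq_lt_of_balanced {X Y U L : ℤ} (h : X + Y = U + L) (h1 : U - L ≤ 1)
    (h2 : -1 ≤ U - L) (h3 : 2 ≤ X - Y ∨ X - Y ≤ -2) : U ^ 2 + L ^ 2 < X ^ 2 + Y ^ 2 := by
  have e1 := sq_add_sq_eq X Y
  have e2 := sq_add_sq_eq U L
  rw [h] at e1
  have h4 : 4 ≤ (X - Y) ^ 2 := by rcases h3 with h3 | h3 <;> nlinarith
  have : (U - L) ^ 2 ≤ 1 := by nlinarith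
  omega

namespace VeroneseIndex

/-- Each summand is a square of a difference of two partial sums, and sorting balances such a
difference between the two members of the pair. No summand pair increases, and one strictly
decreases when the pair is unsorted. -/
theorem weight_lt {a b : VeroneseIndex α n} (hu : a ≠ upper a b) (hl : a ≠ lower a b) :
    (upper a b).weight + (lower a b).weight < a.weight + b.weight := by
  simp only [weight, ← Finset.sum_add_distrib]
  zify
  simp only [sq_abs]
  apply Finset.sum_lt_sum
  · rintro ⟨i, j⟩ hij
    simp only [Finset.mem_product, Finset.mem_range] at hij ⊢
    rw [cum_upper _ _ (by omega), cum_upper _ _ (by omega), cum_lower _ _ (by omega),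
      cum_lower _ _ (by omega)]
    apply sq_add_sq_le_of_balanced <;> omega
  · obtain ⟨j, hj, hju⟩ : ∃ j ≤ n, a.cum j ≠ (upper a b).cum j := by
      by_contra! h
      exact hu (ext_cum h)
    obtain ⟨i, hi, hil⟩ : ∃ j ≤ n, a.cum j ≠ (lower a b).cum j := by
      by_contra! h
      exact hl (ext_cum h)
    rw [cum_upper _ _ hj] at hju
    rw [cum_lower _ _ hi] at hil
    -- With `D = a.cum - b.cum`, sortedness means that `D` takes values only in `{0, 1}` or only in
    -- `{0, -1}`. Otherwise `D` varies by at least two: either one value is at distance two from `D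
    -- 0 = 0`, or both `1` and `-1` occur. The second case is why the weight uses differences of
    -- partial sums at two places.
    have key : ∃ p ≤ n, ∃ q ≤ n, 2 ≤ ((a.cum p : ℤ) - a.cum q) - (b.cum p - b.cum q) := by
      have ha := a.cum_zero
      have hb := b.cum_zero
      by_cases h1 : a.cum j ≥ b.cum j + 2
      · exact ⟨j, hj, 0, Nat.zero_le _, by omega⟩
      by_cases h2 : b.cum i ≥ a.cum i + 2
      · exact ⟨0, Nat.zero_le _, i, hi, by omega⟩
      · exact ⟨i, hi, j, hj, by omega⟩
    obtain ⟨p, hp, q, hq, hpq⟩ := key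
    refine ⟨(p, q), by simp; omega, ?_⟩
    dsimp only
    rw [cum_upper _ _ hp, cum_upper _ _ hq, cum_lower _ _ hp, cum_lower _ _ hq]
    apply sq_add_sq_lt_of_balanced <;> omega

end VeroneseIndex

open VeroneseIndex Finsupp

/-- The exponent vector of the image of a monomial under the toric map. -/
noncomputable def toricExponent (α : Fin k → ℕ) (n : ℕ) :
    (VeroneseIndex α n →₀ ℕ) →ₗ[ℕ] (Fin n →₀ ℕ) :=
  linearCombination ℕ fun a => equivFunOnFinite.symm a.entries

theorem toricExponent_pair (a b : VeroneseIndex α n) :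
    toricExponent α n (single (upper a b) 1 + single (lower a b) 1) =
      toricExponent α n (single a 1 + single b 1) := by
  ext j
  simp [toricExponent, entries_upper_add_lower]

/-- The total of the partial sums of the variables of a monomial is a linear function of its image,
so it is an invariant of the fibre. -/
theorem linearCombination_cum (e : VeroneseIndex α n →₀ ℕ) (j : ℕ) :
    linearCombination ℕ (fun a : VeroneseIndex α n => a.cum j) e =
      linearCombination ℕ (fun i : Fin n => if (i : ℕ) < j then 1 else 0) (toricExponent α n e) := by
  rw [toricExponent, apply_linearCombination]
  congr 2
  funext a
  rw [Function.comp_apply, linearCombination_apply, Finsupp.sum_fintype _ _ (by simp)]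
  simp only [equivFunOnFinite_symm_apply_apply, smul_eq_mul, mul_ite, mul_one, mul_zero]
  rw [cum]
  have h1 : ∑ i ∈ Finset.range j, a.extend i =
      ∑ i ∈ Finset.range n, if i < j then a.extend i else 0 := by
    rw [← Finset.sum_filter]
    have : ∑ i ∈ Finset.range j with i < n, a.extend i = ∑ i ∈ Finset.range j, a.extend i := by
      apply Finset.sum_filter_of_ne
      intro i _ hi
      by_contra h
      exact hi (by simp [extend, h])
    rw [← this]
    apply Finset.sum_congr _ fun _ _ => rfl
    ext i
    simp [and_comm]
  rw [h1, Finset.sum_range]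
  exact Finset.sum_congr rfl fun i _ => by rw [extend_val]

/-- All pairs of variables of the monomial are sorted. -/
def IsSorted (e : VeroneseIndex α n →₀ ℕ) : Prop :=
  ∀ a ∈ e.support, ∀ b ∈ e.support, a = upper a b ∨ a = lower a b

/-- All indices have the same coordinate sum, so the image of a monomial determines its degree as
soon as that sum is nonzero. -/
theorem degree_mul_eq (e : VeroneseIndex α n →₀ ℕ) :
    linearCombination ℕ (fun a : VeroneseIndex α n => a.cum n) e = e.degree * ∑ i, α i := by
  simp only [cum_last, linearCombination_apply, Finsupp.sum, smul_eq_mul, Finsupp.degree_apply,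
    Finset.sum_mul]

/-- The two inequalities say that `a.cum j` is the average of the partial sums, rounded up. Such a
variable exists because the partial sums of any two variables of a sorted monomial are comparable
and differ by at most one. -/
theorem IsSorted.exists_max {e : VeroneseIndex α n →₀ ℕ} (he : IsSorted e) (h0 : e ≠ 0) :
    ∃ a ∈ e.support, ∀ j ≤ n,
      linearCombination ℕ (fun b : VeroneseIndex α n => b.cum j) e ≤ e.degree * a.cum j ∧
      e.degree * a.cum j <
        linearCombination ℕ (fun b : VeroneseIndex α n => b.cum j) e + e.degree := by
  obtain ⟨a, ha, hmax⟩ := Finset.exists_max_image e.support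
    (fun a => ∑ j ∈ Finset.range (n + 1), a.cum j) (support_nonempty_iff.2 h0)
  refine ⟨a, ha, ?_⟩
  have key : ∀ b ∈ e.support, ∀ j ≤ n, b.cum j ≤ a.cum j ∧ a.cum j ≤ b.cum j + 1 := by
    intro b hb j hj
    rcases he a ha b hb with h | h
    · have := congrArg (fun x => x.cum j) h
      simp only [cum_upper _ _ hj] at this
      omega
    -- In this case `b` dominates `a`, so maximality of `a` forces all their partial sums to agree.
    · have hle : ∀ i ≤ n, a.cum i ≤ b.cum i ∧ b.cum i ≤ a.cum i + 1 := by
        intro i hi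
        have := congrArg (fun x => x.cum i) h
        simp only [cum_lower _ _ hi] at this
        omega
      have hle' : ∀ i ∈ Finset.range (n + 1), a.cum i ≤ b.cum i := fun i hi =>
        (hle i (by simpa [Nat.lt_succ_iff] using hi)).1
      have := (Finset.sum_eq_sum_iff_of_le hle').1
        (le_antisymm (Finset.sum_le_sum hle') (hmax b hb)) j (by simp; omega)
      omega
  intro j hj
  simp only [linearCombination_apply, Finsupp.sum, smul_eq_mul, Finsupp.degree_apply,
    Finset.sum_mul, ← Finset.sum_add_distrib]
  constructor
  · exact Finset.sum_le_sum fun b hb => Nat.mul_le_mul_left _ (key b hb j hj).1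
  · apply Finset.sum_lt_sum
    · intro b hb
      calc e b * a.cum j ≤ e b * (b.cum j + 1) := Nat.mul_le_mul_left _ (key b hb j hj).2
        _ = _ := by ring
    · refine ⟨a, ha, ?_⟩
      have := mem_support_iff.1 ha
      omega

/-- The maximal variable is recovered from the image by rounding, so it is common to both monomials;
removing it leaves sorted monomials of smaller degree with equal images. -/
theorem IsSorted.eq_of_toricExponent_eq (hd : ∑ i, α i ≠ 0) {e f : VeroneseIndex α n →₀ ℕ}
    (he : IsSorted e) (hf : IsSorted f) (h : toricExponent α n e = toricExponent α n f) :
    e = f := by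
  induction hm : e.degree generalizing e f with
  | zero =>
    have h1 := degree_mul_eq e
    have h2 := degree_mul_eq f
    rw [linearCombination_cum, h, ← linearCombination_cum, h2, hm, zero_mul] at h1
    have h3 := (Nat.mul_eq_zero.1 h1).resolve_right hd
    rw [(Finsupp.degree_eq_zero_iff e).1 hm, (Finsupp.degree_eq_zero_iff f).1 h3]
  | succ m ih =>
    have hdeg : e.degree = f.degree := by
      have h1 := degree_mul_eq e
      have h2 := degree_mul_eq f
      rw [linearCombination_cum, h, ← linearCombination_cum, h2] at h1
      exact (Nat.eq_of_mul_eq_mul_right (Nat.pos_of_ne_zero hd) h1).symm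
    have he0 : e ≠ 0 := by rintro rfl; simp at hm
    have hf0 : f ≠ 0 := by rintro rfl; simp [hm] at hdeg
    obtain ⟨a, ha, ha'⟩ := he.exists_max he0
    obtain ⟨b, hb, hb'⟩ := hf.exists_max hf0
    have hab : a = b := by
      apply ext_cum
      intro j hj
      have h1 := ha' j hj
      have h2 := hb' j hj
      rw [linearCombination_cum, h] at h1
      rw [linearCombination_cum, ← hdeg] at h2
      have h3 : e.degree * a.cum j < e.degree * (b.cum j + 1) := by rw [mul_add, mul_one]; omega
      have h4 : e.degree * b.cum j < e.degree * (a.cum j + 1) := by rw [mul_add, mul_one]; omega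
      have h3 := Nat.lt_of_mul_lt_mul_left h3
      have h4 := Nat.lt_of_mul_lt_mul_left h4
      omega
    subst hab
    have hea : e - single a 1 + single a 1 = e := tsub_add_cancel_of_le (by
      rw [single_le_iff]; exact Nat.one_le_iff_ne_zero.2 (mem_support_iff.1 ha))
    have hfa : f - single a 1 + single a 1 = f := tsub_add_cancel_of_le (by
      rw [single_le_iff]; exact Nat.one_le_iff_ne_zero.2 (mem_support_iff.1 hb))
    have hsub : ∀ g : VeroneseIndex α n →₀ ℕ, (g - single a 1).support ⊆ g.support :=
      fun g => support_mono tsub_le_self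
    suffices e - single a 1 = f - single a 1 by rw [← hea, ← hfa, this]
    apply ih
    · exact fun x hx y hy => he x (hsub e hx) y (hsub e hy)
    · exact fun x hx y hy => hf x (hsub f hx) y (hsub f hy)
    · rw [← hea, ← hfa, map_add, map_add] at h
      exact add_right_cancel h
    · have := congrArg Finsupp.degree hea
      rw [map_add, Finsupp.degree_single] at this
      omega

/-- A monomial `q` arises from `p` by sorting one unsorted pair of variables. -/
def SortingStep (p q : VeroneseIndex α n →₀ ℕ) : Prop :=
  ∃ a b c, a ≠ upper a b ∧ a ≠ lower a b ∧ p = c + (single a 1 + single b 1) ∧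
    q = c + (single (upper a b) 1 + single (lower a b) 1)

theorem exists_eq_add_of_not_isSorted {p : VeroneseIndex α n →₀ ℕ} (hp : ¬ IsSorted p) :
    ∃ a b c, a ≠ upper a b ∧ a ≠ lower a b ∧ p = c + (single a 1 + single b 1) := by
  simp only [IsSorted, not_forall, not_or] at hp
  obtain ⟨a, ha, b, hb, hu, hl⟩ := hp
  -- A variable paired with itself is sorted. Distinctness matters for divisibility by the product,
  -- since each variable may occur only once.
  have hne : a ≠ b := by
    rintro rfl
    exact hu (upper_self a).symm
  refine ⟨a, b, p - (single a 1 + single b 1), hu, hl, (tsub_add_cancel_of_le ?_).symm⟩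
  intro x
  rw [mem_support_iff] at ha hb
  by_cases hxa : x = a
  · subst hxa
    simp [hne]
    omega
  · by_cases hxb : x = b
    · subst hxb
      simp [hne.symm]
      omega
    · simp [hxa, hxb]

theorem SortingStep.weight_lt {p q : VeroneseIndex α n →₀ ℕ} (h : SortingStep p q) :
    linearCombination ℕ (weight : VeroneseIndex α n → ℕ) q <
      linearCombination ℕ (weight : VeroneseIndex α n → ℕ) p := by
  obtain ⟨a, b, c, hu, hl, rfl, rfl⟩ := h
  simp only [map_add, linearCombination_single, one_smul]
  have := VeroneseIndex.weight_lt hu hl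
  omega

theorem SortingStep.toricExponent_eq {p q : VeroneseIndex α n →₀ ℕ} (h : SortingStep p q) :
    toricExponent α n q = toricExponent α n p := by
  obtain ⟨a, b, c, hu, hl, rfl, rfl⟩ := h
  rw [map_add, toricExponent_pair, ← map_add]

theorem exists_isSorted (p : VeroneseIndex α n →₀ ℕ) :
    ∃ q, IsSorted q ∧ Relation.ReflTransGen SortingStep p q := by
  induction hm : linearCombination ℕ (weight : VeroneseIndex α n → ℕ) p
    using Nat.strong_induction_on generalizing p with
  | _ m ih =>
    by_cases hp : IsSorted p
    · exact ⟨p, hp, .refl⟩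
    · obtain ⟨a, b, c, hu, hl, h⟩ := exists_eq_add_of_not_isSorted hp
      have hs : SortingStep p (c + (single (upper a b) 1 + single (lower a b) 1)) :=
        ⟨a, b, c, hu, hl, h, rfl⟩
      obtain ⟨q, hq, hpq⟩ := ih _ (hm ▸ hs.weight_lt) _ rfl
      exact ⟨q, hq, .head hs hpq⟩

theorem toricExponent_eq_of_reflTransGen {p q : VeroneseIndex α n →₀ ℕ}
    (h : Relation.ReflTransGen SortingStep p q) : toricExponent α n q = toricExponent α n p := by
  induction h with
  | refl => rfl
  | tail _ h ih => rw [h.toricExponent_eq, ih]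

end Sorting

/-! ### A monomial order refining a weight. -/

section WeightOrder

/-- Exponent vectors, ordered by a weight and then lexicographically. -/
def WeightLex {σ : Type*} (_w : σ → ℕ) : Type _ := σ →₀ ℕ

variable {σ : Type*} (w : σ → ℕ)

noncomputable instance : AddCommMonoid (WeightLex w) := inferInstanceAs (AddCommMonoid (σ →₀ ℕ))

variable {w} in
/-- The exponent vector. -/
def WeightLex.exponent (e : WeightLex w) : σ →₀ ℕ := e

theorem WeightLex.exponent_add (e f : WeightLex w) :
    (e + f).exponent = e.exponent + f.exponent := rfl

/-- The additive equivalence with the exponent vectors. -/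
noncomputable def WeightLex.addEquiv : (σ →₀ ℕ) ≃+ WeightLex w := AddEquiv.refl (σ →₀ ℕ)

theorem WeightLex.exponent_addEquiv (e : σ →₀ ℕ) : (WeightLex.addEquiv w e).exponent = e := rfl

/-- The pair of the weight and the exponent vector. -/
noncomputable def WeightLex.toPair (e : WeightLex w) : ℕ ×ₗ Lex (σ →₀ ℕ) :=
  toLex (Finsupp.linearCombination ℕ w e.exponent, toLex e.exponent)

theorem WeightLex.toPair_injective : Function.Injective (WeightLex.toPair w) := fun _ _ h =>
  toLex.injective (congrArg (fun x => (ofLex x).2) h)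

variable [LinearOrder σ]

noncomputable instance : LinearOrder (WeightLex w) :=
  LinearOrder.lift' (WeightLex.toPair w) (WeightLex.toPair_injective w)

theorem WeightLex.le_iff {e f : WeightLex w} : e ≤ f ↔
    Finsupp.linearCombination ℕ w e.exponent < Finsupp.linearCombination ℕ w f.exponent ∨
      Finsupp.linearCombination ℕ w e.exponent = Finsupp.linearCombination ℕ w f.exponent ∧
        toLex e.exponent ≤ toLex f.exponent := by
  change WeightLex.toPair w e ≤ WeightLex.toPair w f ↔ _
  rw [Prod.Lex.le_iff]
  rfl

instance : IsOrderedAddMonoid (WeightLex w) where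
  add_le_add_left e f h g := by
    rw [WeightLex.le_iff] at h ⊢
    simp only [WeightLex.exponent_add, map_add, toLex_add]
    rcases h with h | ⟨h, h'⟩
    · exact Or.inl (by omega)
    · exact Or.inr ⟨by omega, by gcongr⟩

instance [Finite σ] : WellFoundedLT (WeightLex w) :=
  ⟨InvImage.wf (WeightLex.toPair w) wellFounded_lt⟩

/-- The monomial order which compares weights, and then exponent vectors lexicographically. -/
noncomputable def weightOrder [Finite σ] : MonomialOrder σ where
  syn := WeightLex w
  toSyn := WeightLex.addEquiv w
  toSyn_monotone e f h := by
    rw [WeightLex.le_iff, WeightLex.exponent_addEquiv, WeightLex.exponent_addEquiv]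
    obtain ⟨g, rfl⟩ := exists_add_of_le h
    rw [map_add]
    rcases Nat.eq_zero_or_pos (Finsupp.linearCombination ℕ w g) with h0 | h0
    · exact Or.inr ⟨by rw [h0, add_zero], Finsupp.toLex_monotone h⟩
    · exact Or.inl (by omega)

theorem weightOrder_lt [Finite σ] {e f : σ →₀ ℕ}
    (h : Finsupp.linearCombination ℕ w e < Finsupp.linearCombination ℕ w f) :
    (weightOrder w).toSyn e < (weightOrder w).toSyn f := by
  change WeightLex.addEquiv w e < WeightLex.addEquiv w f
  rw [lt_iff_not_ge, WeightLex.le_iff, WeightLex.exponent_addEquiv, WeightLex.exponent_addEquiv]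
  omega

end WeightOrder

/-! ### Toric maps and cancellation in their kernels. -/

section ToricMap

variable {ι τ K : Type*} [Field K]

theorem aeval_monomial_monomial (v : ι → τ →₀ ℕ) (e : ι →₀ ℕ) (c : K) :
    MvPolynomial.aeval (fun i => MvPolynomial.monomial (v i) (1 : K)) (MvPolynomial.monomial e c) =
      MvPolynomial.monomial (Finsupp.linearCombination ℕ v e) c := by
  rw [MvPolynomial.aeval_monomial, Finsupp.linearCombination_apply, MvPolynomial.algebraMap_eq]
  simp only [MvPolynomial.monomial_pow, one_pow]
  conv_rhs => rw [← mul_one c, ← MvPolynomial.C_mul_monomial]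
  rw [MvPolynomial.monomial_finsupp_sum_index]
  simp

end ToricMap

end LaurentChain
namespace LaurentChain

section ToricKernel

variable {ι τ K : Type*} [Field K]

/-- The image of a term can only be cancelled by another term with the same image monomial. -/
theorem exists_ne_mem_support_of_aeval_eq_zero (v : ι → τ →₀ ℕ) {f : MvPolynomial ι K}
    (hf : MvPolynomial.aeval (fun i => MvPolynomial.monomial (v i) (1 : K)) f = 0)
    {e : ι →₀ ℕ} (he : e ∈ f.support) :
    ∃ e' ∈ f.support, e' ≠ e ∧
      Finsupp.linearCombination ℕ v e' = Finsupp.linearCombination ℕ v e := by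
  classical
  by_contra! h
  have h1 := congrArg (MvPolynomial.coeff (Finsupp.linearCombination ℕ v e)) hf
  rw [f.as_sum, map_sum, MvPolynomial.coeff_sum, MvPolynomial.coeff_zero,
    Finset.sum_eq_single_of_mem e he] at h1
  · rw [aeval_monomial_monomial, MvPolynomial.coeff_monomial, if_pos rfl] at h1
    exact MvPolynomial.mem_support_iff.1 he h1
  · intro p hp hpe
    rw [aeval_monomial_monomial, MvPolynomial.coeff_monomial, if_neg (h p hp hpe)]

end ToricKernel

/-! ### The sorting relations as a reduced Gröbner basis. -/

section Groebner

open VeroneseIndex Finsupp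

variable {k n : ℕ} {α : Fin k → ℕ}

/-- The monomial order which compares the strictly convex weights first. -/
noncomputable def sortingOrder (α : Fin k → ℕ) (n : ℕ) : MonomialOrder (VeroneseIndex α n) :=
  letI : LinearOrder (VeroneseIndex α n) :=
    LinearOrder.lift' (Fintype.equivFin (VeroneseIndex α n)) (Equiv.injective _)
  weightOrder weight

theorem SortingStep.lt {p q : VeroneseIndex α n →₀ ℕ} (h : SortingStep p q) :
    (sortingOrder α n).toSyn q < (sortingOrder α n).toSyn p :=
  letI : LinearOrder (VeroneseIndex α n) :=
    LinearOrder.lift' (Fintype.equivFin (VeroneseIndex α n)) (Equiv.injective _)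
  weightOrder_lt _ h.weight_lt

/-- The sorting relations of pairs of variables. -/
def sortingBinomials (K : Type*) [Field K] (α : Fin k → ℕ) (n : ℕ) :
    Set (MvPolynomial (VeroneseIndex α n) K) :=
  {p | ∃ a b, a ≠ upper a b ∧ a ≠ lower a b ∧
    p = MvPolynomial.monomial (single a 1 + single b 1) 1 -
      MvPolynomial.monomial (single (upper a b) 1 + single (lower a b) 1) 1}

theorem veroneseMap_eq (K : Type*) [Field K] (α : Fin k → ℕ) (n : ℕ) :
    veroneseMap K α n = MvPolynomial.aeval fun a : VeroneseIndex α n =>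
      MvPolynomial.monomial (equivFunOnFinite.symm a.entries) (1 : K) := by
  unfold veroneseMap
  congr 1
  funext a
  rw [MvPolynomial.monomial_eq, Finsupp.prod_fintype _ _ (by simp)]
  simp

/-- Every monomial of the fibre descends by sorting steps to a sorted one, and the fibre contains
only one sorted monomial. -/
theorem IsSorted.le_of_toricExponent_eq (hd : ∑ i, α i ≠ 0) {e f : VeroneseIndex α n →₀ ℕ}
    (he : IsSorted e) (h : toricExponent α n f = toricExponent α n e) :
    (sortingOrder α n).toSyn e ≤ (sortingOrder α n).toSyn f := by
  obtain ⟨q, hq, hfq⟩ := exists_isSorted f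
  have : e = q := he.eq_of_toricExponent_eq hd hq (by
    rw [toricExponent_eq_of_reflTransGen hfq, h])
  subst this
  clear he h hq
  induction hfq with
  | refl => exact le_rfl
  | tail _ h ih => exact h.lt.le.trans ih

theorem isReducedGroebnerBasis_sortingBinomials (hd : ∑ i, α i ≠ 0) (K : Type*) [Field K] :
    IsReducedGroebnerBasis (sortingOrder α n) (veroneseIdeal K α n) (sortingBinomials K α n) := by
  classical
  have hstep : ∀ a b : VeroneseIndex α n, a ≠ upper a b → a ≠ lower a b →
      (sortingOrder α n).toSyn (single (upper a b) 1 + single (lower a b) 1) <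
        (sortingOrder α n).toSyn (single a 1 + single b 1) := fun a b hu hl =>
    SortingStep.lt ⟨a, b, 0, hu, hl, (zero_add _).symm, (zero_add _).symm⟩
  have hdeg : ∀ a b : VeroneseIndex α n, a ≠ upper a b → a ≠ lower a b →
      (sortingOrder α n).degree (MvPolynomial.monomial (single a 1 + single b 1) (1 : K) -
        MvPolynomial.monomial (single (upper a b) 1 + single (lower a b) 1) 1) =
        single a 1 + single b 1 := by
    intro a b hu hl
    rw [MonomialOrder.degree_sub_of_lt, MonomialOrder.degree_monomial, if_neg one_ne_zero]
    rw [MonomialOrder.degree_monomial, MonomialOrder.degree_monomial, if_neg one_ne_zero,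
      if_neg one_ne_zero]
    exact hstep a b hu hl
  have hlc : ∀ a b : VeroneseIndex α n, a ≠ upper a b → a ≠ lower a b →
      (sortingOrder α n).leadingCoeff (MvPolynomial.monomial (single a 1 + single b 1) (1 : K) -
        MvPolynomial.monomial (single (upper a b) 1 + single (lower a b) 1) 1) = 1 := by
    intro a b hu hl
    rw [MonomialOrder.leadingCoeff_sub_of_lt, MonomialOrder.leadingCoeff_monomial]
    rw [MonomialOrder.degree_monomial, MonomialOrder.degree_monomial, if_neg one_ne_zero,
      if_neg one_ne_zero]
    exact hstep a b hu hl
  have hsub : sortingBinomials K α n ⊆ veroneseIdeal K α n := by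
    rintro p ⟨a, b, hu, hl, rfl⟩
    rw [SetLike.mem_coe, veroneseIdeal, RingHom.mem_ker, map_sub, veroneseMap_eq,
      aeval_monomial_monomial, aeval_monomial_monomial, sub_eq_zero]
    exact congrArg (fun e => MvPolynomial.monomial e (1 : K)) (toricExponent_pair a b).symm
  refine ⟨hsub, le_antisymm (Ideal.span_mono (Set.image_mono hsub)) ?_, ?_, ?_⟩
  · rw [Ideal.span_le]
    rintro _ ⟨f, hf, rfl⟩
    by_cases h0 : f = 0
    · subst h0
      simp
    have hs := MonomialOrder.degree_mem_support (m := sortingOrder α n) h0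
    rw [SetLike.mem_coe, veroneseIdeal, RingHom.mem_ker, veroneseMap_eq] at hf
    obtain ⟨e', he', hne, heq⟩ := exists_ne_mem_support_of_aeval_eq_zero _ hf hs
    -- A sorted leading monomial would be least in its fibre, yet another monomial of `f` lies in
    -- the same fibre and is no larger.
    have hns : ¬ IsSorted ((sortingOrder α n).degree f) := by
      intro h
      have h1 := h.le_of_toricExponent_eq hd heq
      exact hne ((sortingOrder α n).toSyn.injective
        (le_antisymm (MonomialOrder.le_degree he') h1))
    obtain ⟨a, b, c, hu, hl, hp⟩ := exists_eq_add_of_not_isSorted hns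
    have : (sortingOrder α n).leadingTerm f = MvPolynomial.monomial c
        ((sortingOrder α n).leadingCoeff f) * (sortingOrder α n).leadingTerm
          (MvPolynomial.monomial (single a 1 + single b 1) (1 : K) -
            MvPolynomial.monomial (single (upper a b) 1 + single (lower a b) 1) 1) := by
      rw [MonomialOrder.leadingTerm, MonomialOrder.leadingTerm, hdeg a b hu hl, hlc a b hu hl,
        MvPolynomial.monomial_mul, ← hp, mul_one]
    rw [this, SetLike.mem_coe]
    exact Ideal.mul_mem_left _ _ (Ideal.subset_span ⟨_, ⟨a, b, hu, hl, rfl⟩, rfl⟩)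
  · rintro g ⟨a, b, hu, hl, rfl⟩
    exact hlc a b hu hl
  · rintro g ⟨a, b, hu, hl, rfl⟩ h ⟨a', b', hu', hl', rfl⟩ hne e he hle
    rw [hdeg a' b' hu' hl'] at hle
    have hpair : ∀ x y : VeroneseIndex α n, single a' 1 + single b' 1 ≤ single x 1 + single y 1 →
        (a' = x ∧ b' = y) ∨ (a' = y ∧ b' = x) := by
      intro x y hxy
      have : single a' 1 + single b' 1 = single x 1 + single y 1 := by
        obtain ⟨c, hc⟩ := exists_add_of_le hxy
        have h1 := congrArg Finsupp.degree hc
        simp only [map_add, Finsupp.degree_single] at h1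
        have : c = 0 := (Finsupp.degree_eq_zero_iff c).1 (by omega)
        rw [hc, this, add_zero]
      rw [single_add_single_eq_single_add_single one_ne_zero one_ne_zero]
        at this
      simpa using this
    have he' := MvPolynomial.support_sub _ _ _ he
    rw [MvPolynomial.support_monomial, MvPolynomial.support_monomial, if_neg one_ne_zero,
      if_neg one_ne_zero, Finset.mem_union, Finset.mem_singleton, Finset.mem_singleton] at he'
    rcases he' with rfl | rfl
    -- Divisibility into the leading term forces the same unordered pair, hence the same relation by
    -- symmetry; divisibility into the trailing term is impossible because that pair is already
    -- sorted.
    · rcases hpair _ _ hle with ⟨rfl, rfl⟩ | ⟨rfl, rfl⟩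
      · exact hne rfl
      · apply hne
        rw [upper_comm, lower_comm, add_comm (single a' 1)]
    · rcases hpair _ _ hle with ⟨rfl, rfl⟩ | ⟨rfl, rfl⟩
      · exact hu' (upper_upper_lower a b).symm
      · exact hl' (by
          rw [lower_comm]
          exact ext_cum fun j hj => by
            simp only [cum_upper _ _ hj, cum_lower _ _ hj]
            omega)

end Groebner

end LaurentChain
namespace LaurentChain

/-! ### Laurent ideals and lattices of exponents. -/

section LatticeIdeal

open Finsupp

variable {K : Type*} [Field K] {k n m : ℕ}

theorem laurentMonomial_add (e f : (Fin k ↪ Fin n) →₀ ℤ) :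
    laurentMonomial K (e + f) = laurentMonomial K e * laurentMonomial K f := by
  simp [laurentMonomial, AddMonoidAlgebra.single_mul_single]

theorem laurentMonomial_zero : laurentMonomial K (0 : (Fin k ↪ Fin n) →₀ ℤ) = 1 := rfl

/-- The exponent vectors of the Laurent monomials which are congruent to `1` modulo an ideal. -/
def unitLattice (I : Ideal (LaurentRing K k n)) : AddSubgroup ((Fin k ↪ Fin n) →₀ ℤ) where
  carrier := {e | laurentMonomial K e - 1 ∈ I}
  zero_mem' := by simp [laurentMonomial_zero]
  add_mem' {e f} he hf := by
    have := I.add_mem (I.mul_mem_left (laurentMonomial K f) he) hf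
    rw [Set.mem_ofPred_eq, laurentMonomial_add]
    convert this using 1
    ring
  neg_mem' {e} he := by
    have h := I.mul_mem_left (-laurentMonomial K (-e)) he
    have h1 : laurentMonomial K (-e) * laurentMonomial K e = 1 := by
      rw [← laurentMonomial_add, neg_add_cancel, laurentMonomial_zero]
    rw [Set.mem_ofPred_eq]
    convert h using 1
    rw [mul_sub, neg_mul, h1]
    ring

theorem mem_unitLattice {I : Ideal (LaurentRing K k n)} {e : (Fin k ↪ Fin n) →₀ ℤ} :
    e ∈ unitLattice I ↔ laurentMonomial K e - 1 ∈ I := Iff.rfl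

/-- Since monomials are units, membership of a binomial in an ideal depends only on the difference
of its exponents. -/
theorem sub_mem_iff_mem_unitLattice {I : Ideal (LaurentRing K k n)}
    {e f : (Fin k ↪ Fin n) →₀ ℤ} :
    laurentMonomial K e - laurentMonomial K f ∈ I ↔ e - f ∈ unitLattice I := by
  have h1 : laurentMonomial K e = laurentMonomial K f * laurentMonomial K (e - f) := by
    rw [← laurentMonomial_add, add_sub_cancel]
  rw [mem_unitLattice]
  constructor
  · intro h
    have h2 := I.mul_mem_left (laurentMonomial K (-f)) h
    have h3 : laurentMonomial K (-f) * laurentMonomial K f = 1 := by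
      rw [← laurentMonomial_add, neg_add_cancel, laurentMonomial_zero]
    rw [h1] at h2
    convert h2 using 1
    rw [mul_sub, ← mul_assoc, h3, one_mul]
  · intro h
    have := I.mul_mem_left (laurentMonomial K f) h
    rwa [mul_sub, mul_one, ← h1] at this

theorem laurentMonomial_nsmul (r : ℕ) (e : (Fin k ↪ Fin n) →₀ ℤ) :
    laurentMonomial K (r • e) = laurentMonomial K e ^ r := by
  induction r with
  | zero => simp [laurentMonomial_zero]
  | succ r ih => rw [succ_nsmul, laurentMonomial_add, ih, pow_succ]

theorem laurentMonomial_sum {ι : Type*} (s : Finset ι) (f : ι → (Fin k ↪ Fin n) →₀ ℤ) :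
    laurentMonomial K (∑ i ∈ s, f i) = ∏ i ∈ s, laurentMonomial K (f i) := by
  classical
  induction s using Finset.induction_on with
  | empty => simp [laurentMonomial_zero]
  | insert a s ha ih => rw [Finset.sum_insert ha, Finset.prod_insert ha, laurentMonomial_add, ih]

theorem aeval_laurentMonomial_monomial {ι : Type*} (w : ι → (Fin k ↪ Fin n) →₀ ℤ) (e : ι →₀ ℕ)
    (c : K) : MvPolynomial.aeval (fun i => laurentMonomial K (w i)) (MvPolynomial.monomial e c) =
      c • laurentMonomial K (linearCombination ℕ w e) := by
  rw [MvPolynomial.aeval_monomial, linearCombination_apply, Finsupp.sum, laurentMonomial_sum,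
    Algebra.smul_def]
  simp only [laurentMonomial_nsmul]
  rfl

/-- The exponent vector of the image of a Laurent monomial. -/
noncomputable def tupleExponent (α : Fin k → ℕ) (n : ℕ) :
    ((Fin k ↪ Fin n) →₀ ℤ) →ₗ[ℤ] (Fin n → ℤ) :=
  linearCombination ℤ fun u j => (exponentVector α u j : ℤ)

theorem tupleExponent_single (α : Fin k → ℕ) (u : Fin k ↪ Fin n) (c : ℤ) (j : Fin n) :
    tupleExponent α n (single u c) j = c * exponentVector α u j := by
  simp [tupleExponent]

/-- The inclusion of the exponent vectors of monomials. -/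
noncomputable def natToInt (ι : Type*) : (ι →₀ ℕ) →ₗ[ℕ] (ι →₀ ℤ) :=
  linearCombination ℕ fun i => single i (1 : ℤ)

theorem natToInt_single {ι : Type*} (i : ι) (c : ℕ) :
    natToInt ι (single i c) = single i (c : ℤ) := by
  simp [natToInt]

theorem natToInt_apply {ι : Type*} (p : ι →₀ ℕ) (i : ι) : natToInt ι p i = p i := by
  classical
  induction p using Finsupp.induction_linear with
  | zero => simp
  | add p q hp hq => simp [hp, hq]
  | single j c =>
    rw [natToInt_single, single_apply, single_apply]
    split_ifs <;> simp

theorem exists_eq_natToInt_sub {ι : Type*} (e : ι →₀ ℤ) :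
    ∃ p q : ι →₀ ℕ, e = natToInt ι p - natToInt ι q := by
  refine ⟨e.mapRange Int.toNat rfl, (-e).mapRange Int.toNat rfl, ?_⟩
  ext i
  simp only [Finsupp.sub_apply, natToInt_apply, mapRange_apply, Finsupp.neg_apply]
  omega

/-- The exponent vector of the image of an indeterminate. -/
noncomputable def tupleVector (α : Fin k → ℕ) (u : Fin k ↪ Fin n) : Fin n →₀ ℕ :=
  equivFunOnFinite.symm (exponentVector α u)

theorem tupleExponent_natToInt (α : Fin k → ℕ) (p : (Fin k ↪ Fin n) →₀ ℕ) (j : Fin n) :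
    tupleExponent α n (natToInt _ p) j = (linearCombination ℕ (tupleVector α) p j : ℕ) := by
  induction p using Finsupp.induction_linear with
  | zero => simp
  | add p q hp hq => simp [hp, hq]
  | single u c =>
    rw [natToInt_single, tupleExponent_single]
    simp [tupleVector]

theorem inducedMap_eq (α : Fin k → ℕ) :
    inducedMap (MvPolynomial.monomial (equivFunOnFinite.symm α) (1 : K)) n =
      MvPolynomial.aeval fun u => MvPolynomial.monomial (tupleVector α u) (1 : K) := by
  classical
  unfold inducedMap
  congr 1
  funext u
  change MvPolynomial.aeval (MvPolynomial.X ∘ u) _ = _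
  have h : MvPolynomial.aeval (MvPolynomial.X ∘ u) = MvPolynomial.rename (R := K) u := by
    ext i
    simp
  rw [h, MvPolynomial.rename_monomial]
  refine congrArg (fun e => MvPolynomial.monomial e (1 : K)) ?_
  ext j
  simp [mapDomain, Finsupp.sum_fintype, tupleVector, exponentVector, finsetSum_apply,
    single_apply]

theorem toLaurent_monomial (p : (Fin k ↪ Fin n) →₀ ℕ) (c : K) :
    toLaurent K k n (MvPolynomial.monomial p c) = c • laurentMonomial K (natToInt _ p) :=
  aeval_laurentMonomial_monomial _ _ _

/-- Splitting the exponent into positive and negative parts clears denominators and gives an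
ordinary binomial in the kernel of the toric map. -/
theorem ker_le_unitLattice_laurentIdeal (α : Fin k → ℕ) {e : (Fin k ↪ Fin n) →₀ ℤ}
    (he : tupleExponent α n e = 0) :
    e ∈ unitLattice (laurentIdeal
      (MvPolynomial.monomial (equivFunOnFinite.symm α) (1 : K)) n) := by
  obtain ⟨p, q, rfl⟩ := exists_eq_natToInt_sub e
  rw [← sub_mem_iff_mem_unitLattice]
  have h : MvPolynomial.monomial p (1 : K) - MvPolynomial.monomial q 1 ∈
      inducedIdeal (MvPolynomial.monomial (equivFunOnFinite.symm α) (1 : K)) n := by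
    rw [inducedIdeal, RingHom.mem_ker, inducedMap_eq, map_sub, aeval_monomial_monomial,
      aeval_monomial_monomial, sub_eq_zero]
    refine congrArg (fun e => MvPolynomial.monomial e (1 : K)) ?_
    ext j
    have := congrFun he j
    rw [map_sub, Pi.sub_apply, tupleExponent_natToInt, tupleExponent_natToInt, Pi.zero_apply,
      sub_eq_zero] at this
    exact_mod_cast this
  have := Ideal.mem_map_of_mem (toLaurent K k n) h
  rwa [map_sub, toLaurent_monomial, toLaurent_monomial, one_smul, one_smul] at this

/-- Modulo `I`, the class of a monomial depends only on its image, so the inclusion into the Laurent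
ring factors, modulo `I`, through the toric map. Elements of the toric kernel therefore vanish
modulo `I`. -/
theorem laurentIdeal_le (α : Fin k → ℕ) {I : Ideal (LaurentRing K k n)}
    (hI : ∀ e, tupleExponent α n e = 0 → e ∈ unitLattice I) :
    laurentIdeal (MvPolynomial.monomial (equivFunOnFinite.symm α) (1 : K)) n ≤ I := by
  rw [laurentIdeal, Ideal.map_le_iff_le_comap]
  intro f hf
  rw [inducedIdeal, RingHom.mem_ker, inducedMap_eq] at hf
  rw [Ideal.mem_comap]
  let L := linearCombination ℕ (tupleVector (n := n) α)
  -- A linear section choosing one preimage monomial per exponent. Its value off the range of `L` is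
  -- arbitrary; only exponents of the form `L p` are used.
  let S : MvPolynomial (Fin n) K →ₗ[K] LaurentRing K k n :=
    (MvPolynomial.basisMonomials (Fin n) K).constr K fun β =>
      laurentMonomial K (natToInt _ (Function.invFun L β))
  have hS : ∀ β c, S (MvPolynomial.monomial β c) =
      c • laurentMonomial K (natToInt _ (Function.invFun L β)) := by
    intro β c
    have h1 : MvPolynomial.monomial β c = c • MvPolynomial.basisMonomials (Fin n) K β := by
      rw [MvPolynomial.coe_basisMonomials, MvPolynomial.smul_monomial, smul_eq_mul, mul_one]
    rw [h1, map_smul, Module.Basis.constr_basis]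
  have key : ∀ g : MvPolynomial (Fin k ↪ Fin n) K,
      S (MvPolynomial.aeval (fun u => MvPolynomial.monomial (tupleVector α u) (1 : K)) g) -
        toLaurent K k n g ∈ I := by
    intro g
    induction g using MvPolynomial.induction_on' with
    | monomial p c =>
      rw [aeval_monomial_monomial, hS, toLaurent_monomial, ← smul_sub]
      refine Submodule.smul_of_tower_mem I c ?_
      rw [sub_mem_iff_mem_unitLattice]
      apply hI
      funext j
      rw [map_sub, Pi.sub_apply, tupleExponent_natToInt, tupleExponent_natToInt, Pi.zero_apply,
        sub_eq_zero]
      congr 2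
      exact Function.invFun_eq (f := L) ⟨p, rfl⟩
    | add p q hp hq =>
      have := I.add_mem hp hq
      rw [map_add, map_add, map_add]
      convert this using 1
      ring
  have := key f
  rw [hf, map_zero, zero_sub] at this
  exact neg_mem_iff.1 this

theorem laurentRename_laurentMonomial (e : Fin n ↪ Fin m) (x : (Fin k ↪ Fin n) →₀ ℤ) :
    laurentRename K k e (laurentMonomial K x) =
      laurentMonomial K (mapDomain (fun u : Fin k ↪ Fin n => u.trans e) x) := by
  simp [laurentRename, laurentMonomial]

theorem exponentVector_trans_apply (α : Fin k → ℕ) (u : Fin k ↪ Fin n) (e : Fin n ↪ Fin m)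
    (j : Fin n) : exponentVector α (u.trans e) (e j) = exponentVector α u j := by
  simp [exponentVector]

theorem exponentVector_trans_of_notMem (α : Fin k → ℕ) (u : Fin k ↪ Fin n) (e : Fin n ↪ Fin m)
    {i : Fin m} (hi : i ∉ Set.range e) : exponentVector α (u.trans e) i = 0 := by
  rw [exponentVector]
  refine Finset.sum_eq_zero fun j _ => if_neg ?_
  rintro rfl
  exact hi ⟨_, rfl⟩

theorem tupleExponent_mapDomain_apply (α : Fin k → ℕ) (e : Fin n ↪ Fin m)
    (x : (Fin k ↪ Fin n) →₀ ℤ) (j : Fin n) :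
    tupleExponent α m (mapDomain (fun u : Fin k ↪ Fin n => u.trans e) x) (e j) =
      tupleExponent α n x j := by
  induction x using Finsupp.induction_linear with
  | zero => simp
  | add p q hp hq => simp [mapDomain_add, hp, hq]
  | single u c =>
    rw [mapDomain_single, tupleExponent_single, tupleExponent_single, exponentVector_trans_apply]

theorem tupleExponent_mapDomain_of_notMem (α : Fin k → ℕ) (e : Fin n ↪ Fin m)
    (x : (Fin k ↪ Fin n) →₀ ℤ) {i : Fin m} (hi : i ∉ Set.range e) :
    tupleExponent α m (mapDomain (fun u : Fin k ↪ Fin n => u.trans e) x) i = 0 := by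
  induction x using Finsupp.induction_linear with
  | zero => simp
  | add p q hp hq => simp [mapDomain_add, hp, hq]
  | single u c =>
    rw [mapDomain_single, tupleExponent_single, exponentVector_trans_of_notMem α u e hi]
    simp

theorem tupleExponent_mapDomain_eq_zero_iff (α : Fin k → ℕ) (e : Fin n ↪ Fin m)
    (x : (Fin k ↪ Fin n) →₀ ℤ) :
    tupleExponent α m (mapDomain (fun u : Fin k ↪ Fin n => u.trans e) x) = 0 ↔
      tupleExponent α n x = 0 := by
  constructor
  · intro h
    funext j
    rw [← tupleExponent_mapDomain_apply, h]
    rfl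
  · intro h
    funext i
    by_cases hi : i ∈ Set.range e
    · obtain ⟨j, rfl⟩ := hi
      rw [tupleExponent_mapDomain_apply, h]
      rfl
    · exact tupleExponent_mapDomain_of_notMem α e x hi

end LatticeIdeal

/-! ### Division by the greatest common divisor. -/

section PrimitivePart

variable {k : ℕ}

theorem gcd_ne_zero {α : Fin k → ℕ} (hα : α ≠ 0) : Finset.univ.gcd α ≠ 0 := by
  rw [Ne, Finset.gcd_eq_zero_iff]
  intro h
  exact hα (funext fun i => h i (Finset.mem_univ i))

theorem gcd_mul_primitivePart (α : Fin k → ℕ) (i : Fin k) :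
    Finset.univ.gcd α * primitivePart α i = α i :=
  Nat.mul_div_cancel' (Finset.gcd_dvd (Finset.mem_univ i))

theorem exists_sum_mul_primitivePart_eq_one {α : Fin k → ℕ} (hα : α ≠ 0) :
    ∃ b : Fin k → ℤ, ∑ i, b i * (primitivePart α i : ℤ) = 1 := by
  have h1 : Finset.univ.gcd (primitivePart α) = 1 := by
    obtain ⟨i, hi⟩ : ∃ i, α i ≠ 0 := by
      by_contra! h
      exact hα (funext h)
    exact Finset.gcd_div_eq_one (Finset.mem_univ i) hi
  obtain ⟨c, hc⟩ := Finset.gcd_eq_sum_mul Finset.univ fun i => (primitivePart α i : ℤ)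
  set G := Finset.univ.gcd fun i => (primitivePart α i : ℤ) with hG
  have h2 : G.natAbs ∣ 1 := by
    rw [← h1]
    refine Finset.dvd_gcd fun i hi => ?_
    have : G ∣ (primitivePart α i : ℤ) := Finset.gcd_dvd hi
    exact Int.natAbs_dvd_natAbs.2 this
  have h3 : G * G = 1 := by
    rw [← Int.natAbs_mul_self, Nat.dvd_one.1 h2]
    rfl
  -- The integer gcd `G` is a unit; multiplying by it again absorbs its sign.
  refine ⟨fun i => c i * G, ?_⟩
  rw [← h3]
  nth_rewrite 2 [hc]
  rw [Finset.sum_mul]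
  exact Finset.sum_congr rfl fun i _ => by ring

theorem sum_primitivePart_ne_zero {α : Fin k → ℕ} (hα : α ≠ 0) :
    ∑ i, primitivePart α i ≠ 0 := by
  intro h
  apply hα
  funext i
  rw [← gcd_mul_primitivePart α, (Finset.sum_eq_zero_iff.1 h) i (Finset.mem_univ i)]
  simp

theorem tupleExponent_primitivePart {n : ℕ} (α : Fin k → ℕ) (e : (Fin k ↪ Fin n) →₀ ℤ) :
    tupleExponent α n e =
      ((Finset.univ.gcd α : ℕ) : ℤ) • tupleExponent (primitivePart α) n e := by
  funext j
  induction e using Finsupp.induction_linear with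
  | zero => simp
  | add p q hp hq =>
    simp only [map_add, Pi.add_apply, hp, hq, Pi.smul_apply, smul_add]
  | single u c =>
    simp only [Pi.smul_apply, tupleExponent_single, exponentVector]
    conv_lhs => simp only [← gcd_mul_primitivePart α]
    push_cast
    simp only [smul_eq_mul, Finset.mul_sum]
    refine Finset.sum_congr rfl fun i _ => ?_
    split_ifs
    · ring
    · simp

/-- Scaling the exponent map by the nonzero gcd does not change its kernel, so `α` and its primitive
part define the same Laurent ideals. -/
theorem tupleExponent_eq_zero_iff {n : ℕ} {α : Fin k → ℕ} (hα : α ≠ 0)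
    (e : (Fin k ↪ Fin n) →₀ ℤ) :
    tupleExponent α n e = 0 ↔ tupleExponent (primitivePart α) n e = 0 := by
  rw [tupleExponent_primitivePart, smul_eq_zero, or_iff_right]
  exact_mod_cast gcd_ne_zero hα

end PrimitivePart

end LaurentChain
namespace LaurentChain

/-! ### Generators of the lattice of relations, and their localization to `N`-sets. -/

section LatticeGenerators

open Finsupp VeroneseIndex

variable {k n m : ℕ} {α : Fin k → ℕ}

theorem exponentVector_apply_self (α : Fin k → ℕ) (u : Fin k ↪ Fin n) (i : Fin k) :
    exponentVector α u (u i) = α i := by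
  simp [exponentVector]

theorem exponentVector_of_notMem (α : Fin k → ℕ) (u : Fin k ↪ Fin n) {j : Fin n}
    (hj : ∀ i, u i ≠ j) : exponentVector α u j = 0 :=
  Finset.sum_eq_zero fun i _ => if_neg (hj i)

theorem sum_exponentVector (α : Fin k → ℕ) (u : Fin k ↪ Fin n) :
    ∑ j, exponentVector α u j = ∑ i, α i := by
  simp only [exponentVector]
  rw [Finset.sum_comm]
  simp

theorem exponentVector_le (α : Fin k → ℕ) (u : Fin k ↪ Fin n) (j : Fin n) :
    exponentVector α u j ≤ Finset.univ.sup α := by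
  by_cases h : ∃ i, u i = j
  · obtain ⟨i, rfl⟩ := h
    rw [exponentVector_apply_self]
    exact Finset.le_sup (Finset.mem_univ i)
  · push Not at h
    rw [exponentVector_of_notMem α u h]
    exact Nat.zero_le _

theorem exponentVector_trans_swap (α : Fin k → ℕ) (u : Fin k ↪ Fin n) (x y j : Fin n) :
    exponentVector α (u.trans (Equiv.swap x y).toEmbedding) j =
      exponentVector α u (Equiv.swap x y j) := by
  have := exponentVector_trans_apply α u (Equiv.swap x y).toEmbedding (Equiv.swap x y j)
  simpa using this

/-- The index whose entries form the exponent vector of a tuple. -/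
def tupleIndex (α : Fin k → ℕ) (u : Fin k ↪ Fin n) : VeroneseIndex α n :=
  ⟨fun j => ⟨exponentVector α u j, Nat.lt_succ_of_le (exponentVector_le α u j)⟩,
    sum_exponentVector α u⟩

theorem entries_tupleIndex (α : Fin k → ℕ) (u : Fin k ↪ Fin n) :
    (tupleIndex α u).entries = exponentVector α u := rfl

theorem toricExponent_mapDomain_tupleIndex (p : (Fin k ↪ Fin n) →₀ ℕ) :
    toricExponent α n (mapDomain (tupleIndex α) p) = linearCombination ℕ (tupleVector α) p := by
  rw [toricExponent, linearCombination_mapDomain]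
  rfl

/-- A subgroup contains the kernel of the exponent map if it contains the images of the sorting
relations under a lift of the indices to exponents of Laurent monomials. -/
theorem mem_of_tupleExponent_eq_zero (hd : ∑ i, α i ≠ 0)
    (ψ : VeroneseIndex α n → ((Fin k ↪ Fin n) →₀ ℤ)) (M : AddSubgroup ((Fin k ↪ Fin n) →₀ ℤ))
    (h1 : ∀ a b, a ≠ upper a b → a ≠ lower a b →
      (ψ a + ψ b) - (ψ (upper a b) + ψ (lower a b)) ∈ M)
    (h2 : ∀ u, single u 1 - ψ (tupleIndex α u) ∈ M) {e : (Fin k ↪ Fin n) →₀ ℤ}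
    (he : tupleExponent α n e = 0) : e ∈ M := by
  obtain ⟨p, q, rfl⟩ := exists_eq_natToInt_sub e
  have hpsi : ∀ p : (Fin k ↪ Fin n) →₀ ℕ,
      natToInt _ p - linearCombination ℕ ψ (mapDomain (tupleIndex α) p) ∈ M := by
    intro p
    induction p using Finsupp.induction_linear with
    | zero => simp [M.zero_mem]
    | add p q hp hq =>
      have := M.add_mem hp hq
      rw [mapDomain_add, map_add, map_add]
      convert this using 1
      abel
    | single u c =>
      have := M.nsmul_mem (h2 u) c
      rw [mapDomain_single, natToInt_single, linearCombination_single]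
      convert this using 1
      rw [nsmul_sub, smul_single, nsmul_one]
  have hred : ∀ p q : VeroneseIndex α n →₀ ℕ, Relation.ReflTransGen SortingStep p q →
      linearCombination ℕ ψ p - linearCombination ℕ ψ q ∈ M := by
    intro p q h
    induction h with
    | refl => simp [M.zero_mem]
    | tail _ h ih =>
      obtain ⟨a, b, c, hu, hl, rfl, rfl⟩ := h
      have := M.add_mem ih (h1 a b hu hl)
      simp only [map_add, linearCombination_single, one_smul] at this ⊢
      convert this using 1
      abel
  obtain ⟨s, hs, hps⟩ := exists_isSorted (mapDomain (tupleIndex α) p)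
  obtain ⟨t, ht, hqt⟩ := exists_isSorted (mapDomain (tupleIndex α) q)
  -- Both sides of the relation sort to the same monomial, since their images agree and sorted
  -- monomials are normal forms.
  have hst : s = t := by
    apply hs.eq_of_toricExponent_eq hd ht
    rw [toricExponent_eq_of_reflTransGen hps, toricExponent_eq_of_reflTransGen hqt,
      toricExponent_mapDomain_tupleIndex, toricExponent_mapDomain_tupleIndex]
    ext j
    have := congrFun he j
    rw [map_sub, Pi.sub_apply, tupleExponent_natToInt, tupleExponent_natToInt, Pi.zero_apply,
      sub_eq_zero] at this
    exact_mod_cast this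
  subst hst
  have := M.sub_mem (M.add_mem (hpsi p) (hred _ _ hps)) (M.add_mem (hpsi q) (hred _ _ hqt))
  convert this using 1
  abel

theorem sum_smul_single_sub_single (l : Fin n) (δ : Fin n → ℤ) (hδ : ∑ j, δ j = 0) :
    ∑ j, δ j • (Pi.single j 1 - Pi.single l 1 : Fin n → ℤ) = δ := by
  simp only [smul_sub, Finset.sum_sub_distrib, ← Finset.sum_smul, hδ, zero_smul, sub_zero]
  funext x
  simp [Finset.sum_apply, Pi.single_apply]

/-- The first transposition brings the entry `α i` to position `j` without disturbing the zero at
`l`. Exchanging `j` and `l` then only moves this entry, so all other coordinates cancel. -/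
theorem tupleExponent_swap_sub_swap (u₀ : Fin k ↪ Fin n) {l : Fin n}
    (hl : exponentVector α u₀ l = 0) (i : Fin k) (hil : u₀ i ≠ l) {j : Fin n} (hj : j ≠ l) :
    tupleExponent α n (single (u₀.trans (Equiv.swap (u₀ i) j).toEmbedding) 1 -
      single ((u₀.trans (Equiv.swap (u₀ i) j).toEmbedding).trans (Equiv.swap j l).toEmbedding) 1) =
        (α i : ℤ) • (Pi.single j 1 - Pi.single l 1) := by
  funext x
  simp only [map_sub, Pi.sub_apply, tupleExponent_single, one_mul, exponentVector_trans_swap,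
    Pi.smul_apply]
  have e1 : exponentVector α u₀ (Equiv.swap (u₀ i) j j) = α i := by
    rw [Equiv.swap_apply_right, exponentVector_apply_self]
  have e2 : exponentVector α u₀ (Equiv.swap (u₀ i) j l) = 0 := by
    rw [Equiv.swap_apply_of_ne_of_ne hil.symm hj.symm, hl]
  by_cases hxj : x = j
  · subst hxj
    rw [Equiv.swap_apply_left x l, e1, e2]
    simp [hj]
  · by_cases hxl : x = l
    · subst hxl
      rw [Equiv.swap_apply_right j x, e1, e2]
      simp [hxj]
    · rw [Equiv.swap_apply_of_ne_of_ne hxj hxl]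
      simp [hxj, hxl]

/-- The exponent vectors which involve only tuples with entries in a given set. -/
noncomputable def supportedOn (k : ℕ) (T : Finset (Fin n)) :
    Submodule ℤ ((Fin k ↪ Fin n) →₀ ℤ) :=
  supported ℤ ℤ {u | ∀ i, u i ∈ T}

theorem single_mem_supportedOn {T : Finset (Fin n)} {u : Fin k ↪ Fin n} (hu : ∀ i, u i ∈ T)
    (c : ℤ) : single u c ∈ supportedOn k T :=
  single_mem_supported ℤ c hu

theorem supportedOn_mono {S T : Finset (Fin n)} (h : S ⊆ T) :
    supportedOn k S ≤ supportedOn k T :=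
  supported_mono fun _ hu i => h (hu i)

theorem tupleExponent_apply_of_notMem {T : Finset (Fin n)} {w : (Fin k ↪ Fin n) →₀ ℤ}
    (hw : w ∈ supportedOn k T) {x : Fin n} (hx : x ∉ T) : tupleExponent α n w x = 0 := by
  rw [tupleExponent, linearCombination_apply, Finsupp.sum, Finset.sum_apply]
  refine Finset.sum_eq_zero fun u hu => ?_
  have hu' := (mem_supported ℤ w).1 hw hu
  rw [Pi.smul_apply, exponentVector_of_notMem α u]
  · simp
  · rintro i rfl
    exact hx (hu' i)

/-- Bézout combines the multiples of `e_j - e_l` by the `α i` into `e_j - e_l` itself. Any `γ` with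
the right sum differs from the vector of `u₀` by a combination of these. All transpositions used
preserve `T`. -/
theorem exists_mem_supportedOn_of_zero {b : Fin k → ℤ} (hb : ∑ i, b i * (α i : ℤ) = 1)
    {T : Finset (Fin n)} {u₀ : Fin k ↪ Fin n} (hu₀ : ∀ i, u₀ i ∈ T) {l : Fin n} (hlT : l ∈ T)
    (hl : exponentVector α u₀ l = 0) {γ : Fin n → ℤ} (hγ : ∑ j, γ j = ∑ i, (α i : ℤ))
    (hγT : ∀ x ∉ T, γ x = 0) : ∃ w ∈ supportedOn k T, tupleExponent α n w = γ := by
  suffices γ ∈ (supportedOn k T).map (tupleExponent α n) from this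
  set P := (supportedOn k T).map (tupleExponent α n) with hP
  have hu₀P : (fun j => (exponentVector α u₀ j : ℤ)) ∈ P :=
    ⟨single u₀ 1, single_mem_supportedOn hu₀ 1, by funext j; simp [tupleExponent_single]⟩
  have hdiff : ∀ j ∈ T, (Pi.single j 1 - Pi.single l 1 : Fin n → ℤ) ∈ P := by
    intro j hjT
    by_cases hj : j = l
    · subst hj
      simp [P.zero_mem]
    have h1 : ∀ i, (α i : ℤ) • (Pi.single j 1 - Pi.single l 1 : Fin n → ℤ) ∈ P := by
      intro i
      by_cases hil : u₀ i = l
      · have : α i = 0 := by rw [← exponentVector_apply_self α u₀ i, hil, hl]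
        simp [this, P.zero_mem]
      · rw [← tupleExponent_swap_sub_swap u₀ hl i hil hj]
        have hsw : ∀ x ∈ T, ∀ y ∈ T, ∀ z ∈ T, Equiv.swap x y z ∈ T := by
          intro x hx y hy z hz
          rw [Equiv.swap_apply_def]
          split_ifs <;> assumption
        have h2 : ∀ i', u₀.trans (Equiv.swap (u₀ i) j).toEmbedding i' ∈ T := fun i' =>
          hsw _ (hu₀ i) _ hjT _ (hu₀ i')
        exact ⟨_, Submodule.sub_mem _ (single_mem_supportedOn h2 1)
          (single_mem_supportedOn (fun i' => hsw _ hjT _ hlT _ (h2 i')) 1), rfl⟩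
    have h3 : (Pi.single j 1 - Pi.single l 1 : Fin n → ℤ) =
        ∑ i, b i • (α i : ℤ) • (Pi.single j 1 - Pi.single l 1 : Fin n → ℤ) := by
      simp only [smul_smul, ← Finset.sum_smul, hb, one_smul]
    rw [h3]
    exact P.sum_mem fun i _ => P.smul_mem _ (h1 i)
  have hsum : ∑ j, (γ j - (exponentVector α u₀ j : ℤ)) = 0 := by
    rw [Finset.sum_sub_distrib, hγ, sub_eq_zero]
    exact_mod_cast (sum_exponentVector α u₀).symm
  have h4 := sum_smul_single_sub_single l _ hsum
  have h5 : γ = (fun j => (exponentVector α u₀ j : ℤ)) +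
      ∑ j, (γ j - (exponentVector α u₀ j : ℤ)) • (Pi.single j 1 - Pi.single l 1) := by
    rw [h4]
    funext j
    simp
  rw [h5]
  refine P.add_mem hu₀P (P.sum_mem fun j _ => ?_)
  by_cases hjT : j ∈ T
  · exact P.smul_mem _ (hdiff j hjT)
  · have : exponentVector α u₀ j = 0 :=
      exponentVector_of_notMem α u₀ fun i hi => hjT (hi ▸ hu₀ i)
    rw [hγT j hjT, this]
    simp [P.zero_mem]

theorem exists_embedding_mem {T : Finset (Fin n)} (hT : k ≤ T.card) :
    ∃ u : Fin k ↪ Fin n, ∀ i, u i ∈ T := by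
  obtain ⟨f⟩ : Nonempty (Fin k ↪ T) := Function.Embedding.nonempty_of_card_le (by simpa using hT)
  exact ⟨f.trans (Function.Embedding.subtype _), fun i => (f i).2⟩

/-- The bound on `T` guarantees a position in `T` where the vector of `u₀` vanishes, except when `T`
is a single point, where there is only one vector of the right sum. The bound is one less than `2d`
so that it survives deleting an index from an `N`-set. -/
theorem exists_mem_supportedOn {b : Fin k → ℤ} (hb : ∑ i, b i * (α i : ℤ) = 1)
    {T : Finset (Fin n)} (hk : k ≤ T.card) (hT : 2 * ∑ i, α i ≤ T.card + 1)
    {γ : Fin n → ℤ} (hγ : ∑ j, γ j = ∑ i, (α i : ℤ)) (hγT : ∀ x ∉ T, γ x = 0) :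
    ∃ w ∈ supportedOn k T, tupleExponent α n w = γ := by
  obtain ⟨u₀, hu₀⟩ := exists_embedding_mem hk
  by_cases h0 : ∃ l ∈ T, exponentVector α u₀ l = 0
  · obtain ⟨l, hlT, hl⟩ := h0
    exact exists_mem_supportedOn_of_zero hb hu₀ hlT hl hγ hγT
  · push Not at h0
    have h1 : T.card ≤ ∑ i, α i := by
      rw [← sum_exponentVector α u₀, Finset.card_eq_sum_ones]
      calc ∑ x ∈ T, 1 ≤ ∑ x ∈ T, exponentVector α u₀ x :=
            Finset.sum_le_sum fun x hx => Nat.one_le_iff_ne_zero.2 (h0 x hx)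
        _ ≤ _ := Finset.sum_le_sum_of_subset (Finset.subset_univ T)
    have h2 : T.card ≠ 0 := by
      intro h
      have : k = 0 := by omega
      subst this
      simp at hb
    -- From `T.card ≤ d` and `2 * d ≤ T.card + 1` one gets `d ≤ 1`, and `T` is nonempty.
    have h3 : T.card = 1 := by omega
    obtain ⟨t, rfl⟩ := Finset.card_eq_one.1 h3
    refine ⟨single u₀ 1, single_mem_supportedOn hu₀ 1, ?_⟩
    have hγ' := hγ
    have hu := sum_exponentVector α u₀
    funext x
    rw [tupleExponent_single, one_mul]
    by_cases hx : x = t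
    · subst hx
      rw [Finset.sum_eq_single_of_mem x (Finset.mem_univ x)
        fun y _ hy => hγT y (by simpa using hy)] at hγ'
      rw [Finset.sum_eq_single_of_mem x (Finset.mem_univ x) fun y _ hy =>
        exponentVector_of_notMem α u₀ fun i hi => hy (by
          rw [← hi]; simpa using hu₀ i)] at hu
      rw [hγ', hu]
      push_cast
      rfl
    · rw [hγT x (by simpa using hx), exponentVector_of_notMem α u₀ fun i hi => hx (by
        rw [← hi]; simpa using hu₀ i)]
      simp

/-- Two representations of an index vector by tuples with entries in small sets agree modulo the
relations among such tuples. -/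
theorem sub_mem_of_supportedOn {b : Fin k → ℤ} (hb : ∑ i, b i * (α i : ℤ) = 1) {N : ℕ}
    (hkN : k + 1 ≤ N) (hdN : 2 * ∑ i, α i ≤ N) {M : AddSubgroup ((Fin k ↪ Fin m) →₀ ℤ)}
    (hM : ∀ T : Finset (Fin m), T.card = N → ∀ w ∈ supportedOn k T,
      tupleExponent α m w = 0 → w ∈ M)
    {S T : Finset (Fin m)} (hS : S.card = N) (hT : T.card = N) {v w : (Fin k ↪ Fin m) →₀ ℤ}
    (hv : v ∈ supportedOn k S) (hw : w ∈ supportedOn k T)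
    (hvw : tupleExponent α m v = tupleExponent α m w)
    (hsum : ∑ j, tupleExponent α m v j = ∑ i, (α i : ℤ)) : v - w ∈ M := by
  induction hr : (S \ T).card generalizing S v with
  | zero =>
    have hST : S = T := Finset.eq_of_subset_of_card_le
      (Finset.sdiff_eq_empty_iff_subset.1 (Finset.card_eq_zero.1 hr)) (by omega)
    subst hST
    exact hM S hS _ (Submodule.sub_mem _ hv hw) (by rw [map_sub, hvw, sub_self])
  | succ r ih =>
    obtain ⟨x, hx⟩ : (S \ T).Nonempty := Finset.card_pos.1 (by omega)
    obtain ⟨y, hy⟩ : (T \ S).Nonempty := by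
      apply Finset.card_pos.1
      have := Finset.card_sdiff_add_card_inter S T
      have := Finset.card_sdiff_add_card_inter T S
      rw [Finset.inter_comm] at this
      omega
    rw [Finset.mem_sdiff] at hx hy
    have hcard : (S.erase x).card = N - 1 := by rw [Finset.card_erase_of_mem hx.1, hS]
    -- The common image vanishes at `x`, because `w` does not involve `x`. So it can be represented
    -- without `x`, for which `N - 1` indices must suffice; this uses `k + 1 ≤ N` as well as `2d ≤
    -- N`.
    obtain ⟨z, hz, hzv⟩ := exists_mem_supportedOn (T := S.erase x) hb (by omega) (by omega) hsum
      (fun i hi => by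
        by_cases hix : i = x
        · subst hix
          rw [hvw]
          exact tupleExponent_apply_of_notMem hw hx.2
        · exact tupleExponent_apply_of_notMem hv fun h => hi (Finset.mem_erase.2 ⟨hix, h⟩))
    have h1 : v - z ∈ M := hM S hS _
      (Submodule.sub_mem _ hv (supportedOn_mono (Finset.erase_subset x S) hz))
      (by rw [map_sub, hzv, sub_self])
    have hyS : y ∉ S.erase x := fun h => hy.2 (Finset.mem_of_mem_erase h)
    have h2 : z - w ∈ M := by
      -- Replacing `x` by `y ∈ T` restores the cardinality `N` and brings the set one step closer to
      -- `T`.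
      apply ih (S := insert y (S.erase x))
      · rw [Finset.card_insert_of_notMem hyS, hcard]
        omega
      · exact supportedOn_mono (Finset.subset_insert _ _) hz
      · rw [hzv, hvw]
      · rw [hzv, hsum]
      · rw [Finset.insert_sdiff_of_mem _ hy.1, Finset.erase_sdiff_comm,
          Finset.card_erase_of_mem (Finset.mem_sdiff.2 hx), hr]
        rfl
    simpa using M.add_mem h1 h2

theorem card_support_entries_le (a : VeroneseIndex α n) :
    (Finset.univ.filter fun j => a.entries j ≠ 0).card ≤ ∑ i, α i := by
  rw [← a.sum_entries, Finset.card_eq_sum_ones]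
  calc ∑ x ∈ Finset.univ.filter fun j => a.entries j ≠ 0, 1
      ≤ ∑ x ∈ Finset.univ.filter fun j => a.entries j ≠ 0, a.entries x :=
        Finset.sum_le_sum fun x hx => Nat.one_le_iff_ne_zero.2 (Finset.mem_filter.1 hx).2
    _ ≤ _ := Finset.sum_le_sum_of_subset (Finset.subset_univ _)

/-- All relations among the exponent vectors are generated by those which involve few indices. -/
theorem mem_of_forall_supportedOn {b : Fin k → ℤ} (hb : ∑ i, b i * (α i : ℤ) = 1) {N : ℕ}
    (hkN : k + 1 ≤ N) (hdN : 2 * ∑ i, α i ≤ N) (hNm : N ≤ m)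
    {M : AddSubgroup ((Fin k ↪ Fin m) →₀ ℤ)}
    (hM : ∀ T : Finset (Fin m), T.card = N → ∀ w ∈ supportedOn k T,
      tupleExponent α m w = 0 → w ∈ M)
    {e : (Fin k ↪ Fin m) →₀ ℤ} (he : tupleExponent α m e = 0) : e ∈ M := by
  classical
  have hd : ∑ i, α i ≠ 0 := by
    intro h
    have : ∀ i, α i = 0 := fun i => (Finset.sum_eq_zero_iff.1 h) i (Finset.mem_univ i)
    simp [this] at hb
  have hsum : ∀ a : VeroneseIndex α m, ∑ j, (a.entries j : ℤ) = ∑ i, (α i : ℤ) := fun a => by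
    exact_mod_cast a.sum_entries
  have hex : ∀ (a : VeroneseIndex α m) (T : Finset (Fin m)), T.card = N →
      (∀ x ∉ T, a.entries x = 0) →
      ∃ w ∈ supportedOn k T, tupleExponent α m w = fun j => (a.entries j : ℤ) := by
    intro a T hT haT
    exact exists_mem_supportedOn hb (by omega) (by omega) (hsum a)
      fun x hx => by exact_mod_cast haT x hx
  have hψ : ∀ a : VeroneseIndex α m, ∃ v, ∀ T : Finset (Fin m), T.card = N →
      ∀ w ∈ supportedOn k T, (tupleExponent α m w = fun j => (a.entries j : ℤ)) →
        v - w ∈ M := by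
    intro a
    -- The support has at most `d` positions. The lift is taken over one `N`-set containing it, and
    -- the exchange argument makes it independent of that set modulo `M`.
    obtain ⟨S, hS, hScard⟩ := Finset.exists_superset_card_eq (n := N)
      ((card_support_entries_le a).trans (by omega)) (by simpa using hNm)
    obtain ⟨v, hv, hva⟩ := hex a S hScard fun x hx => by
      by_contra h
      exact hx (hS (by simpa using h))
    refine ⟨v, fun T hT w hw hwa => ?_⟩
    exact sub_mem_of_supportedOn hb hkN hdN hM hScard hT hv hw (by rw [hva, hwa])
      (by rw [hva, hsum])
  choose ψ hψ using hψ
  refine mem_of_tupleExponent_eq_zero hd ψ M ?_ ?_ he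
  · intro a b _ _
    -- The supports of `a` and `b` together have at most `2d` positions, so the whole sorting
    -- relation lives on one `N`-set. This is where the quadratic degree enters.
    obtain ⟨T, hT, hTcard⟩ := Finset.exists_superset_card_eq (n := N)
      (s := (Finset.univ.filter fun j => a.entries j ≠ 0) ∪
        Finset.univ.filter fun j => b.entries j ≠ 0)
      ((Finset.card_union_le _ _).trans (by
        have := card_support_entries_le a
        have := card_support_entries_le b
        omega)) (by simpa using hNm)
    have hab : ∀ x ∉ T, a.entries x = 0 ∧ b.entries x = 0 := by
      intro x hx
      by_contra h
      refine hx (hT ?_)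
      simp only [Finset.mem_union, Finset.mem_filter, Finset.mem_univ, true_and]
      tauto
    have hul : ∀ x ∉ T, (upper a b).entries x = 0 ∧ (lower a b).entries x = 0 := by
      intro x hx
      have h1 := entries_upper_add_lower a b x
      have h2 := hab x hx
      omega
    obtain ⟨wa, hwa, hwa'⟩ := hex a T hTcard fun x hx => (hab x hx).1
    obtain ⟨wb, hwb, hwb'⟩ := hex b T hTcard fun x hx => (hab x hx).2
    obtain ⟨wu, hwu, hwu'⟩ := hex _ T hTcard fun x hx => (hul x hx).1
    obtain ⟨wl, hwl, hwl'⟩ := hex _ T hTcard fun x hx => (hul x hx).2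
    have h0 : wa + wb - (wu + wl) ∈ M := by
      refine hM T hTcard _ (Submodule.sub_mem _ (Submodule.add_mem _ hwa hwb)
        (Submodule.add_mem _ hwu hwl)) ?_
      rw [map_sub, map_add, map_add, hwa', hwb', hwu', hwl', sub_eq_zero]
      funext j
      have := entries_upper_add_lower a b j
      simp only [Pi.add_apply]
      exact_mod_cast this.symm
    have h1 := M.add_mem (hψ a T hTcard wa hwa hwa') (hψ b T hTcard wb hwb hwb')
    have h2 := M.add_mem (hψ _ T hTcard wu hwu hwu') (hψ _ T hTcard wl hwl hwl')
    have := M.add_mem (M.sub_mem h1 h2) h0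
    convert this using 1
    abel
  · intro u
    obtain ⟨T, hT, hTcard⟩ := Finset.exists_superset_card_eq (n := N)
      (s := Finset.univ.map u) (by simp; omega) (by simpa using hNm)
    have := hψ (tupleIndex α u) T hTcard (single u 1)
      (single_mem_supportedOn (fun i => hT (by simp)) 1)
      (by funext j; rw [tupleExponent_single, one_mul, entries_tupleIndex])
    simpa using M.neg_mem this

end LatticeGenerators

/-! ### From the lattice at level `N` to the whole chain. -/

section Chain

open Finsupp

variable {K : Type*} [Field K] {k N : ℕ} {α : Fin k → ℕ}

theorem exists_mapDomain_of_mem_supportedOn {m : ℕ} {T : Finset (Fin m)} (e : Fin N ↪ Fin m)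
    (he : ∀ x ∈ T, x ∈ Set.range e) {w : (Fin k ↪ Fin m) →₀ ℤ} (hw : w ∈ supportedOn k T) :
    ∃ x : (Fin k ↪ Fin N) →₀ ℤ, mapDomain (fun u => u.trans e) x = w := by
  have hinj : Function.Injective fun u : Fin k ↪ Fin N => u.trans e := by
    intro u v h
    ext i
    have := DFunLike.congr_fun h i
    exact congrArg Fin.val (e.injective this)
  refine ⟨w.comapDomain _ hinj.injOn, mapDomain_comapDomain _ hinj w ?_⟩
  intro u hu
  have hu' := (mem_supported ℤ w).1 hw hu
  choose v hv using fun i => he (u i) (hu' i)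
  refine ⟨⟨v, fun i j hij => u.injective ?_⟩, ?_⟩
  · rw [← hv i, ← hv j, hij]
  · ext i
    exact congrArg Fin.val (hv i)

/-- A bijection from the initial segment onto `T` extends to a permutation of the finite ambient
set. -/
theorem exists_perm_forall_mem_range {m : ℕ} (h : N ≤ m) {T : Finset (Fin m)} (hT : T.card = N) :
    ∃ σ : Equiv.Perm (Fin m), ∀ x ∈ T, x ∈ Set.range ((Fin.castLEEmb h).trans σ.toEmbedding) := by
  have e : {x // x ∈ Set.range (Fin.castLEEmb h)} ≃ {x // x ∈ T} :=
    (Equiv.ofInjective _ (Fin.castLEEmb h).injective).symm.trans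
      (Finset.equivFinOfCardEq hT).symm
  refine ⟨e.extendSubtype, fun x hx => ?_⟩
  obtain ⟨y, hy⟩ := (e.symm ⟨x, hx⟩).2
  refine ⟨y, ?_⟩
  change e.extendSubtype (Fin.castLEEmb h y) = x
  rw [Equiv.extendSubtype_apply_of_mem e _ ⟨y, rfl⟩]
  have : (⟨Fin.castLEEmb h y, ⟨y, rfl⟩⟩ : {x // x ∈ Set.range (Fin.castLEEmb h)}) =
    e.symm ⟨x, hx⟩ := Subtype.ext hy
  rw [this, Equiv.apply_symm_apply]

/-- Reduces the chain statement to the single level `N`: a relation on an `N`-set is the translate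
of a relation at level `N`, and translation is a ring homomorphism carrying the span of `G` into the
span of its translates. -/
theorem generatesLaurentChain_of_ker_le (hα : α ≠ 0) {b : Fin k → ℤ}
    (hb : ∑ i, b i * (primitivePart α i : ℤ) = 1)
    (hkN : k + 1 ≤ N) (hdN : 2 * ∑ i, primitivePart α i ≤ N)
    {G : Set (LaurentRing K k N)}
    (hG : ∀ g ∈ G, ∃ e f, g = laurentMonomial K e - laurentMonomial K f ∧
      tupleExponent (primitivePart α) N e = tupleExponent (primitivePart α) N f)
    (hker : ∀ e, tupleExponent (primitivePart α) N e = 0 → e ∈ unitLattice (Ideal.span G)) :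
    GeneratesLaurentChain (MvPolynomial.monomial (equivFunOnFinite.symm α) (1 : K)) N G := by
  constructor
  · apply le_antisymm
    · rw [Ideal.span_le]
      intro g hg
      obtain ⟨e, f, rfl, hef⟩ := hG g hg
      rw [SetLike.mem_coe, sub_mem_iff_mem_unitLattice]
      apply ker_le_unitLattice_laurentIdeal
      rw [tupleExponent_eq_zero_iff hα, map_sub, hef, sub_self]
    · exact laurentIdeal_le α fun e he => hker e ((tupleExponent_eq_zero_iff hα e).1 he)
  · intro m h
    apply le_antisymm
    · rw [Ideal.span_le]
      rintro _ ⟨σ, g, hg, rfl⟩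
      obtain ⟨e, f, rfl, hef⟩ := hG g hg
      simp only [map_sub, laurentRename_laurentMonomial]
      rw [SetLike.mem_coe, sub_mem_iff_mem_unitLattice]
      apply ker_le_unitLattice_laurentIdeal
      rw [tupleExponent_eq_zero_iff hα, ← mapDomain_sub, ← mapDomain_sub,
        tupleExponent_mapDomain_eq_zero_iff, tupleExponent_mapDomain_eq_zero_iff, map_sub, hef,
        sub_self]
    · refine laurentIdeal_le α fun e he => ?_
      rw [tupleExponent_eq_zero_iff hα] at he
      refine mem_of_forall_supportedOn hb hkN hdN h (fun T hT w hw hw0 => ?_) he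
      obtain ⟨σ, hσ⟩ := exists_perm_forall_mem_range h hT
      obtain ⟨x, rfl⟩ := exists_mapDomain_of_mem_supportedOn _ hσ hw
      rw [tupleExponent_mapDomain_eq_zero_iff] at hw0
      have hx := mem_unitLattice.1 (hker x hw0)
      let φ : LaurentRing K k N →+* LaurentRing K k m :=
        ((laurentRename K k σ.toEmbedding).comp (laurentRename K k (Fin.castLEEmb h))).toRingHom
      have h1 : Ideal.map φ (Ideal.span G) ≤ Ideal.span (translates h G) := by
        rw [Ideal.map_span, Ideal.span_le]
        rintro _ ⟨g, hg, rfl⟩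
        exact Ideal.subset_span ⟨σ, g, hg, rfl⟩
      have h2 := h1 (Ideal.mem_map_of_mem φ hx)
      rw [map_sub, map_one] at h2
      rw [mem_unitLattice]
      convert h2 using 2
      change _ = laurentRename K k σ.toEmbedding (laurentRename K k (Fin.castLEEmb h) _)
      rw [laurentRename_laurentMonomial, laurentRename_laurentMonomial, ← mapDomain_comp]
      rfl

end Chain

end LaurentChain
namespace LaurentChain

/-! ### Closure properties of primitive recursive functions on lists. -/

section PrimrecLemmas

open Primrec

variable {γ δ σ : Type*} [Primcodable γ] [Primcodable δ] [Primcodable σ]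

theorem primrec_map {f : γ → List δ} {g : γ → δ → σ} (hf : Primrec f)
    (hg : Primrec fun p : γ × δ => g p.1 p.2) : Primrec fun c => (f c).map (g c) :=
  list_map hf hg

theorem primrec_flatMap {f : γ → List δ} {g : γ → δ → List σ} (hf : Primrec f)
    (hg : Primrec fun p : γ × δ => g p.1 p.2) : Primrec fun c => (f c).flatMap (g c) :=
  list_flatMap hf hg

theorem primrec_filter {f : γ → List δ} {r : γ → δ → Prop} [DecidableRel r] (hf : Primrec f)
    (hr : PrimrecPred fun p : γ × δ => r p.1 p.2) :
    Primrec fun c => (f c).filter fun x => r c x := by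
  have h : PrimrecRel fun (x : δ) (c : γ) => r c x := PrimrecPred.comp hr (snd.pair fst)
  exact (PrimrecRel.listFilter h).comp hf .id

theorem primrec_sum {f : γ → List ℕ} (hf : Primrec f) : Primrec fun c => (f c).sum :=
  list_foldr (h := fun _ p => p.1 + p.2) hf (const 0) (nat_add.comp (fst.comp snd) (snd.comp snd))

theorem primrec_getD {f : γ → List ℕ} {i : γ → ℕ} (hf : Primrec f) (hi : Primrec i) :
    Primrec fun c => (f c).getD (i c) 0 :=
  (list_getD 0).comp hf hi

theorem primrec_range {f : γ → ℕ} (hf : Primrec f) : Primrec fun c => List.range (f c) :=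
  list_range.comp hf

theorem primrec_add {f g : γ → ℕ} (hf : Primrec f) (hg : Primrec g) :
    Primrec fun c => f c + g c := nat_add.comp hf hg

theorem primrec_sub {f g : γ → ℕ} (hf : Primrec f) (hg : Primrec g) :
    Primrec fun c => f c - g c := nat_sub.comp hf hg

theorem primrec_mul {f g : γ → ℕ} (hf : Primrec f) (hg : Primrec g) :
    Primrec fun c => f c * g c := nat_mul.comp hf hg

theorem primrec_div {f g : γ → ℕ} (hf : Primrec f) (hg : Primrec g) :
    Primrec fun c => f c / g c := nat_div.comp hf hg

theorem primrec_eq {f g : γ → δ} (hf : Primrec f) (hg : Primrec g) :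
    PrimrecPred fun c => f c = g c := PrimrecRel.comp Primrec.eq hf hg

theorem primrec_singleton {f : γ → δ} (hf : Primrec f) : Primrec fun c => [f c] :=
  list_cons.comp hf (const [])

theorem primrec_cons {f : γ → δ} {g : γ → List δ} (hf : Primrec f) (hg : Primrec g) :
    Primrec fun c => f c :: g c := list_cons.comp hf hg

theorem primrec_append {f g : γ → List δ} (hf : Primrec f) (hg : Primrec g) :
    Primrec fun c => f c ++ g c := list_append.comp hf hg

theorem primrec_replicate {f : γ → ℕ} {g : γ → δ} (hf : Primrec f) (hg : Primrec g) :
    Primrec fun c => List.replicate (f c) (g c) :=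
  (primrec_map (g := fun c _ => g c) (primrec_range hf) (hg.comp fst)).of_eq fun c => by simp

theorem primrec_mem {f : γ → δ} {g : γ → List δ} (hf : Primrec f) (hg : Primrec g) :
    PrimrecPred fun c => f c ∈ g c :=
  ((PrimrecRel.exists_mem_list (R := fun a b : δ => a = b) Primrec.eq).comp hg hf).of_eq
    fun c => by simp

end PrimrecLemmas

/-! ### The constructions as functions on lists; positions beyond the end of a list count as zero.
-/

section ListAlgorithms

/-- The greatest common divisor of the entries of a list, not all of which are zero. -/
def listGcd (l : List ℕ) : ℕ := Nat.findGreatest (fun g => ∀ x ∈ l, x / g * g = x) l.sum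

/-- The list of the entries divided by their greatest common divisor. -/
def listPrimitivePart (l : List ℕ) : List ℕ := l.map fun x => x / listGcd l

/-- The number of indices. -/
def listBound (A : List ℕ) : ℕ := max (2 * A.sum) (A.length + 1)

/-- The sum of the first `j` entries. -/
def listCum (a : List ℕ) (j : ℕ) : ℕ := ((List.range j).map fun i => a.getD i 0).sum

/-- The first half of the sorting of a pair. -/
def listUpper (a b : List ℕ) : List ℕ :=
  (List.range a.length).map fun i =>
    (listCum a (i + 1) + listCum b (i + 1) + 1) / 2 - (listCum a i + listCum b i + 1) / 2

/-- The second half of the sorting of a pair. -/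
def listLower (a b : List ℕ) : List ℕ :=
  (List.range a.length).map fun i =>
    (listCum a (i + 1) + listCum b (i + 1)) / 2 - (listCum a i + listCum b i) / 2

/-- The maximum of the entries. -/
def listMax (A : List ℕ) : ℕ := A.foldr max 0

/-- All lists of length `n` with entries less than `r`. -/
def boundedLists (r n : ℕ) : List (List ℕ) :=
  Nat.rec [[]] (fun _ L => L.flatMap fun w => (List.range r).map fun x => x :: w) n

/-- All lists of length `k` with pairwise distinct entries less than `n`. -/
def distinctLists (n k : ℕ) : List (List ℕ) :=
  Nat.rec [[]] (fun _ L => L.flatMap fun w =>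
    ((List.range n).filter fun x => ¬ x ∈ w).map fun x => x :: w) k

/-- All codes of elements of `VeroneseIndex`. -/
def veroneseCodes (A : List ℕ) (n : ℕ) : List (List ℕ) :=
  (boundedLists (listMax A + 1) n).filter fun w => w.sum = A.sum

/-- The codes of the sorting relations. -/
def groebnerCodes (A : List ℕ) (n : ℕ) : List (MonomialCode × MonomialCode) :=
  (veroneseCodes A n).flatMap fun a =>
    ((veroneseCodes A n).filter fun b => ¬ a = listUpper a b ∧ ¬ a = listLower a b).map fun b =>
      ([a, b], [listUpper a b, listLower a b])

/-- The exponent vector of the image of the indeterminate of a tuple. -/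
def listExponent (A : List ℕ) (n : ℕ) (u : List ℕ) : List ℕ :=
  (List.range n).map fun j =>
    ((List.range A.length).map fun i => if u.getD i 0 = j then A.getD i 0 else 0).sum

/-- The transposition of `x` and `y`. -/
def natSwap (x y z : ℕ) : ℕ := if z = x then y else if z = y then x else z

/-- The code of the numerator tuple of the factor with indices `i`, `j`. -/
def numeratorTuple (k i j : ℕ) : List ℕ := (List.range k).map fun t => natSwap i j t

/-- The code of the denominator tuple of the factor with indices `i`, `j`. -/
def denominatorTuple (k n i j : ℕ) : List ℕ :=
  (List.range k).map fun t => natSwap j (n - 1) (natSwap i j t)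

/-- The nonnegative parts of the exponents of the explicit decomposition, for `b = p - q`. -/
def decompositionSide (A : List ℕ) (n : ℕ) (p q a : List ℕ) : MonomialCode :=
  (List.range (n - 1)).flatMap fun j => (List.range A.length).flatMap fun i =>
    List.replicate (a.getD j 0 * p.getD i 0 + A.getD j 0 * q.getD i 0)
      (numeratorTuple A.length i j) ++
    List.replicate (a.getD j 0 * q.getD i 0 + A.getD j 0 * p.getD i 0)
      (denominatorTuple A.length n i j)

/-- The tuples with a given exponent vector. -/
def preimages (A : List ℕ) (n : ℕ) (a : List ℕ) : List (List ℕ) :=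
  (distinctLists n A.length).filter fun u => listExponent A n u = a

/-- The code of the monomial quotient which replaces an indeterminate. -/
def quotientCode (A : List ℕ) (n : ℕ) (b : List ℕ × List ℕ) (a : List ℕ) : QuotientCode :=
  if preimages A n a = [] then
    (List.range A.length :: decompositionSide A n b.1 b.2 a, decompositionSide A n b.2 b.1 a)
  else ((preimages A n a).take 1, [])

/-- The code of the monomial quotient which replaces a monomial. -/
def monomialQuotientCode (A : List ℕ) (n : ℕ) (b : List ℕ × List ℕ) (c : MonomialCode) :
    QuotientCode :=
  (c.flatMap fun a => (quotientCode A n b a).1, c.flatMap fun a => (quotientCode A n b a).2)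

/-- The codes of the linear binomials. -/
def linearCodes (A : List ℕ) (n : ℕ) : List (QuotientCode × QuotientCode) :=
  (distinctLists n A.length).flatMap fun u =>
    ((distinctLists n A.length).filter fun v =>
      ¬ u = v ∧ listExponent A n u = listExponent A n v).map fun v => (([u], []), ([v], []))

/-- The codes of the generators of the Laurent chain. -/
def generatorCodes (A : List ℕ) (n : ℕ) (b : List ℕ × List ℕ) :
    List (QuotientCode × QuotientCode) :=
  ((groebnerCodes A n).map fun c =>
    (monomialQuotientCode A n b c.1, monomialQuotientCode A n b c.2)) ++ linearCodes A n

/-- The sum of the products of the entries. -/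
def listDot (A p : List ℕ) : ℕ := ((List.range A.length).map fun i => p.getD i 0 * A.getD i 0).sum

/-- A test for coefficients `b = p - q` of a Bézout relation of the primitive part. -/
def bezoutTest (l : List ℕ) (i : ℕ) : Option (List ℕ × List ℕ) :=
  (Encodable.decode (α := List ℕ × List ℕ) i).bind fun b =>
    if listGcd l = 0 ∨ listDot (listPrimitivePart l) b.1 = listDot (listPrimitivePart l) b.2 + 1
    then some b else none

end ListAlgorithms

/-! ### Primitive recursiveness of the list functions. -/

section PrimrecAlgorithms

open Primrec

variable {γ : Type*} [Primcodable γ]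

theorem primrec_listGcd : Primrec listGcd := by
  refine nat_findGreatest (primrec_sum .id) ?_
  have h : PrimrecRel fun (x g : ℕ) => x / g * g = x :=
    primrec_eq (primrec_mul (primrec_div fst snd) snd) fst
  exact PrimrecRel.forall_mem_list h

theorem primrec_listPrimitivePart : Primrec listPrimitivePart :=
  primrec_map .id (primrec_div snd (primrec_listGcd.comp fst))

theorem primrec_listBound : Primrec listBound :=
  nat_max.comp (primrec_mul (const 2) (primrec_sum .id)) (succ.comp list_length)

theorem primrec_listCum {a : γ → List ℕ} {j : γ → ℕ} (ha : Primrec a) (hj : Primrec j) :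
    Primrec fun c => listCum (a c) (j c) :=
  primrec_sum (primrec_map (primrec_range hj) (primrec_getD (ha.comp fst) snd))

theorem primrec_listUpper {a b : γ → List ℕ} (ha : Primrec a) (hb : Primrec b) :
    Primrec fun c => listUpper (a c) (b c) :=
  primrec_map (primrec_range (list_length.comp ha)) (primrec_sub
    (primrec_div (primrec_add (primrec_add
      (primrec_listCum (ha.comp fst) (primrec_add snd (const 1)))
      (primrec_listCum (hb.comp fst) (primrec_add snd (const 1)))) (const 1)) (const 2))
    (primrec_div (primrec_add (primrec_add
      (primrec_listCum (ha.comp fst) snd) (primrec_listCum (hb.comp fst) snd)) (const 1))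
      (const 2)))

theorem primrec_listLower {a b : γ → List ℕ} (ha : Primrec a) (hb : Primrec b) :
    Primrec fun c => listLower (a c) (b c) :=
  primrec_map (primrec_range (list_length.comp ha)) (primrec_sub
    (primrec_div (primrec_add
      (primrec_listCum (ha.comp fst) (primrec_add snd (const 1)))
      (primrec_listCum (hb.comp fst) (primrec_add snd (const 1)))) (const 2))
    (primrec_div (primrec_add
      (primrec_listCum (ha.comp fst) snd) (primrec_listCum (hb.comp fst) snd)) (const 2)))

theorem primrec_listMax : Primrec listMax :=
  list_foldr (h := fun _ p => max p.1 p.2) .id (const 0) (nat_max.comp (fst.comp snd) (snd.comp snd))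

theorem primrec_boundedLists {r n : γ → ℕ} (hr : Primrec r) (hn : Primrec n) :
    Primrec fun c => boundedLists (r c) (n c) := by
  have h1 : Primrec fun x : (γ × ℕ × List (List ℕ)) × List ℕ =>
      (List.range (r x.1.1)).map fun y => y :: x.2 :=
    primrec_map (primrec_range (hr.comp (fst.comp fst))) (primrec_cons snd (snd.comp fst))
  have h2 : Primrec₂ fun (c : γ) (p : ℕ × List (List ℕ)) =>
      p.2.flatMap fun w => (List.range (r c)).map fun y => y :: w :=
    primrec_flatMap (γ := γ × ℕ × List (List ℕ))
      (g := fun x w => (List.range (r x.1)).map fun y => y :: w) (snd.comp snd) h1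
  exact nat_rec' hn (const [[]]) h2

theorem primrec_distinctLists {n k : γ → ℕ} (hn : Primrec n) (hk : Primrec k) :
    Primrec fun c => distinctLists (n c) (k c) := by
  have h1 : Primrec fun x : (γ × ℕ × List (List ℕ)) × List ℕ =>
      ((List.range (n x.1.1)).filter fun y => ¬ y ∈ x.2).map fun y => y :: x.2 :=
    primrec_map (primrec_filter (primrec_range (hn.comp (fst.comp fst)))
      (primrec_mem snd (snd.comp fst)).not) (primrec_cons snd (snd.comp fst))
  have h2 : Primrec₂ fun (c : γ) (p : ℕ × List (List ℕ)) => p.2.flatMap fun w =>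
      ((List.range (n c)).filter fun y => ¬ y ∈ w).map fun y => y :: w :=
    primrec_flatMap (γ := γ × ℕ × List (List ℕ))
      (g := fun x (w : List ℕ) =>
        ((List.range (n x.1)).filter fun y => decide (¬ y ∈ w)).map fun y => y :: w)
      (snd.comp snd) h1
  exact nat_rec' hk (const [[]]) h2

theorem primrec_veroneseCodes {A : γ → List ℕ} {n : γ → ℕ} (hA : Primrec A) (hn : Primrec n) :
    Primrec fun c => veroneseCodes (A c) (n c) :=
  primrec_filter (primrec_boundedLists (primrec_add (primrec_listMax.comp hA) (const 1)) hn)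
    (primrec_eq (primrec_sum snd) (primrec_sum (hA.comp fst)))

theorem primrec_groebnerCodes {A : γ → List ℕ} {n : γ → ℕ} (hA : Primrec A) (hn : Primrec n) :
    Primrec fun c => groebnerCodes (A c) (n c) :=
  primrec_flatMap (primrec_veroneseCodes hA hn) (primrec_map
    (primrec_filter (primrec_veroneseCodes (hA.comp fst) (hn.comp fst))
      ((primrec_eq (snd.comp fst) (primrec_listUpper (snd.comp fst) snd)).not.and
        (primrec_eq (snd.comp fst) (primrec_listLower (snd.comp fst) snd)).not))
    (Primrec.pair (primrec_cons (snd.comp fst) (primrec_singleton snd))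
      (primrec_cons (primrec_listUpper (snd.comp fst) snd)
        (primrec_singleton (primrec_listLower (snd.comp fst) snd)))))

theorem primrec_listExponent {A u : γ → List ℕ} {n : γ → ℕ} (hA : Primrec A) (hn : Primrec n)
    (hu : Primrec u) : Primrec fun c => listExponent (A c) (n c) (u c) :=
  primrec_map (primrec_range hn) (primrec_sum (primrec_map
    (primrec_range (list_length.comp (hA.comp fst)))
    (Primrec.ite (primrec_eq (primrec_getD (hu.comp (fst.comp fst)) snd) (snd.comp fst))
      (primrec_getD (hA.comp (fst.comp fst)) snd) (const 0))))

theorem primrec_natSwap {x y z : γ → ℕ} (hx : Primrec x) (hy : Primrec y) (hz : Primrec z) :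
    Primrec fun c => natSwap (x c) (y c) (z c) :=
  Primrec.ite (primrec_eq hz hx) hy (Primrec.ite (primrec_eq hz hy) hx hz)

theorem primrec_numeratorTuple {k i j : γ → ℕ} (hk : Primrec k) (hi : Primrec i)
    (hj : Primrec j) : Primrec fun c => numeratorTuple (k c) (i c) (j c) :=
  primrec_map (primrec_range hk) (primrec_natSwap (hi.comp fst) (hj.comp fst) snd)

theorem primrec_denominatorTuple {k n i j : γ → ℕ} (hk : Primrec k) (hn : Primrec n)
    (hi : Primrec i) (hj : Primrec j) :
    Primrec fun c => denominatorTuple (k c) (n c) (i c) (j c) :=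
  primrec_map (primrec_range hk) (primrec_natSwap (hj.comp fst)
    (primrec_sub (hn.comp fst) (const 1)) (primrec_natSwap (hi.comp fst) (hj.comp fst) snd))

theorem primrec_decompositionSide {A p q a : γ → List ℕ} {n : γ → ℕ} (hA : Primrec A)
    (hn : Primrec n) (hp : Primrec p) (hq : Primrec q) (ha : Primrec a) :
    Primrec fun c => decompositionSide (A c) (n c) (p c) (q c) (a c) := by
  have f2 : Primrec fun x : (γ × ℕ) × ℕ => x.1.1 := fst.comp fst
  have g2 : Primrec fun x : (γ × ℕ) × ℕ => x.1.2 := snd.comp fst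
  refine primrec_flatMap (primrec_range (primrec_sub hn (const 1)))
    (primrec_flatMap (primrec_range (list_length.comp (hA.comp fst)))
      (primrec_append (primrec_replicate (primrec_add ?_ ?_) ?_)
        (primrec_replicate (primrec_add ?_ ?_) ?_)))
  · exact primrec_mul (primrec_getD (ha.comp f2) g2) (primrec_getD (hp.comp f2) snd)
  · exact primrec_mul (primrec_getD (hA.comp f2) g2) (primrec_getD (hq.comp f2) snd)
  · exact primrec_numeratorTuple (list_length.comp (hA.comp f2)) snd g2
  · exact primrec_mul (primrec_getD (ha.comp f2) g2) (primrec_getD (hq.comp f2) snd)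
  · exact primrec_mul (primrec_getD (hA.comp f2) g2) (primrec_getD (hp.comp f2) snd)
  · exact primrec_denominatorTuple (list_length.comp (hA.comp f2)) (hn.comp f2) snd g2

theorem primrec_preimages {A a : γ → List ℕ} {n : γ → ℕ} (hA : Primrec A) (hn : Primrec n)
    (ha : Primrec a) : Primrec fun c => preimages (A c) (n c) (a c) :=
  primrec_filter (primrec_distinctLists hn (list_length.comp hA))
    (primrec_eq (primrec_listExponent (hA.comp fst) (hn.comp fst) snd) (ha.comp fst))

theorem primrec_quotientCode {A a : γ → List ℕ} {n : γ → ℕ} {b : γ → List ℕ × List ℕ}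
    (hA : Primrec A) (hn : Primrec n) (hb : Primrec b) (ha : Primrec a) :
    Primrec fun c => quotientCode (A c) (n c) (b c) (a c) :=
  Primrec.ite (primrec_eq (primrec_preimages hA hn ha) (const []))
    (Primrec.pair (primrec_cons (primrec_range (list_length.comp hA))
      (primrec_decompositionSide hA hn (fst.comp hb) (snd.comp hb) ha))
      (primrec_decompositionSide hA hn (snd.comp hb) (fst.comp hb) ha))
    (Primrec.pair (list_take.comp (const 1) (primrec_preimages hA hn ha)) (const []))

theorem primrec_monomialQuotientCode {A : γ → List ℕ} {n : γ → ℕ} {b : γ → List ℕ × List ℕ}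
    {m : γ → MonomialCode} (hA : Primrec A) (hn : Primrec n) (hb : Primrec b) (hm : Primrec m) :
    Primrec fun c => monomialQuotientCode (A c) (n c) (b c) (m c) :=
  Primrec.pair
    (primrec_flatMap hm (fst.comp
      (primrec_quotientCode (hA.comp fst) (hn.comp fst) (hb.comp fst) snd)))
    (primrec_flatMap hm (snd.comp
      (primrec_quotientCode (hA.comp fst) (hn.comp fst) (hb.comp fst) snd)))

theorem primrec_linearCodes {A : γ → List ℕ} {n : γ → ℕ} (hA : Primrec A) (hn : Primrec n) :
    Primrec fun c => linearCodes (A c) (n c) :=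
  primrec_flatMap (primrec_distinctLists hn (list_length.comp hA)) (primrec_map
    (primrec_filter (primrec_distinctLists (hn.comp fst) (list_length.comp (hA.comp fst)))
      ((primrec_eq (snd.comp fst) snd).not.and
        (primrec_eq (primrec_listExponent (hA.comp (fst.comp fst)) (hn.comp (fst.comp fst))
            (snd.comp fst))
          (primrec_listExponent (hA.comp (fst.comp fst)) (hn.comp (fst.comp fst)) snd))))
    (Primrec.pair (Primrec.pair (primrec_singleton (snd.comp fst)) (const []))
      (Primrec.pair (primrec_singleton snd) (const []))))

theorem primrec_generatorCodes {A : γ → List ℕ} {n : γ → ℕ} {b : γ → List ℕ × List ℕ}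
    (hA : Primrec A) (hn : Primrec n) (hb : Primrec b) :
    Primrec fun c => generatorCodes (A c) (n c) (b c) :=
  primrec_append (primrec_map (primrec_groebnerCodes hA hn)
    (Primrec.pair
      (primrec_monomialQuotientCode (hA.comp fst) (hn.comp fst) (hb.comp fst) (fst.comp snd))
      (primrec_monomialQuotientCode (hA.comp fst) (hn.comp fst) (hb.comp fst) (snd.comp snd))))
    (primrec_linearCodes hA hn)

theorem primrec_listDot {A p : γ → List ℕ} (hA : Primrec A) (hp : Primrec p) :
    Primrec fun c => listDot (A c) (p c) :=
  primrec_sum (primrec_map (primrec_range (list_length.comp hA))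
    (primrec_mul (primrec_getD (hp.comp fst) snd) (primrec_getD (hA.comp fst) snd)))

theorem primrec_bezoutTest : Primrec₂ bezoutTest := by
  have f1 : Primrec fun x : (List ℕ × ℕ) × (List ℕ × List ℕ) => x.1.1 := fst.comp fst
  refine Primrec.option_bind (Primrec.decode.comp snd) (Primrec.ite (PrimrecPred.or ?_ ?_)
    (Primrec.option_some.comp snd) (const none))
  · exact primrec_eq (primrec_listGcd.comp f1) (const 0)
  · exact primrec_eq (primrec_listDot (primrec_listPrimitivePart.comp f1) (fst.comp snd))
      (primrec_add (primrec_listDot (primrec_listPrimitivePart.comp f1) (snd.comp snd)) (const 1))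

end PrimrecAlgorithms

end LaurentChain
namespace LaurentChain

/-! ### Correctness of the list functions on codes of indices. -/

section CodesOfIndices

open VeroneseIndex

variable {k n : ℕ}

theorem getD_ofFn (f : Fin n → ℕ) (i : ℕ) :
    (List.ofFn f).getD i 0 = if h : i < n then f ⟨i, h⟩ else 0 := by
  rw [List.getD_eq_getElem?_getD, List.getElem?_ofFn]
  split_ifs <;> rfl

theorem getD_ofFn_val (f : Fin n → ℕ) (i : Fin n) : (List.ofFn f).getD i 0 = f i := by
  rw [getD_ofFn, dif_pos i.2]

theorem map_range_eq_ofFn (f : ℕ → ℕ) (n : ℕ) :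
    (List.range n).map f = List.ofFn fun i : Fin n => f i := by
  apply List.ext_getElem <;> simp

/-- The bounded search up to the sum succeeds because the gcd divides some nonzero entry, which is
at most the sum; any other common divisor divides the gcd and is therefore not larger. -/
theorem listGcd_ofFn {α : Fin k → ℕ} (hα : α ≠ 0) :
    listGcd (List.ofFn α) = Finset.univ.gcd α := by
  have h0 := gcd_ne_zero hα
  obtain ⟨i, hi⟩ : ∃ i, α i ≠ 0 := by
    by_contra! h
    exact hα (funext h)
  rw [listGcd, Nat.findGreatest_eq_iff]
  refine ⟨?_, fun _ => ?_, fun m hm _ hdvd => ?_⟩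
  · rw [List.sum_ofFn]
    exact (Nat.le_of_dvd (Nat.pos_of_ne_zero hi) (Finset.gcd_dvd (Finset.mem_univ i))).trans
      (Finset.single_le_sum (f := α) (fun _ _ => Nat.zero_le _) (Finset.mem_univ i))
  · rintro x hx
    obtain ⟨i, rfl⟩ := (List.mem_ofFn' _ _).1 hx
    exact Nat.div_mul_cancel (Finset.gcd_dvd (Finset.mem_univ i))
  · have : m ∣ Finset.univ.gcd α := Finset.dvd_gcd fun i _ =>
      Dvd.intro_left _ (hdvd (α i) ((List.mem_ofFn' _ _).2 ⟨i, rfl⟩))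
    exact absurd (Nat.le_of_dvd (Nat.pos_of_ne_zero h0) this) (by omega)

theorem listPrimitivePart_ofFn {α : Fin k → ℕ} (hα : α ≠ 0) :
    listPrimitivePart (List.ofFn α) = List.ofFn (primitivePart α) := by
  rw [listPrimitivePart, listGcd_ofFn hα, List.map_ofFn]
  rfl

theorem listBound_ofFn_primitivePart (α : Fin k → ℕ) :
    listBound (List.ofFn (primitivePart α)) = bound α := by
  rw [listBound, List.sum_ofFn, List.length_ofFn, bound]

theorem listMax_le_iff (l : List ℕ) (m : ℕ) : listMax l ≤ m ↔ ∀ x ∈ l, x ≤ m := by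
  induction l with
  | nil => simp [listMax]
  | cons x l ih =>
    simp only [listMax] at ih
    simp [listMax, ih]

theorem listMax_ofFn (β : Fin k → ℕ) : listMax (List.ofFn β) = Finset.univ.sup β := by
  apply eq_of_forall_ge_iff
  intro m
  rw [listMax_le_iff, Finset.sup_le_iff]
  constructor
  · intro h i _
    exact h _ ((List.mem_ofFn' _ _).2 ⟨i, rfl⟩)
  · rintro h x hx
    obtain ⟨i, rfl⟩ := (List.mem_ofFn' _ _).1 hx
    exact h i (Finset.mem_univ i)

theorem mem_boundedLists {r : ℕ} {w : List ℕ} :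
    w ∈ boundedLists r n ↔ w.length = n ∧ ∀ x ∈ w, x < r := by
  induction n generalizing w with
  | zero => simp +contextual [boundedLists]
  | succ n ih =>
    have : boundedLists r (n + 1) =
      (boundedLists r n).flatMap fun w => (List.range r).map fun x => x :: w := rfl
    rw [this, List.mem_flatMap]
    simp only [List.mem_map, List.mem_range, ih]
    constructor
    · rintro ⟨w, ⟨rfl, hw⟩, x, hx, rfl⟩
      simpa using ⟨hx, hw⟩
    · rintro ⟨hl, hw⟩
      cases w with
      | nil => simp at hl
      | cons x w =>
        simp only [List.length_cons, Nat.add_right_cancel_iff, List.mem_cons, forall_eq_or_imp]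
          at hl hw
        exact ⟨w, ⟨hl, hw.2⟩, x, hw.1, rfl⟩

theorem mem_distinctLists {w : List ℕ} :
    w ∈ distinctLists n k ↔ w.length = k ∧ w.Nodup ∧ ∀ x ∈ w, x < n := by
  induction k generalizing w with
  | zero => simp +contextual [distinctLists]
  | succ k ih =>
    have : distinctLists n (k + 1) = (distinctLists n k).flatMap fun w =>
      ((List.range n).filter fun x => ¬ x ∈ w).map fun x => x :: w := rfl
    rw [this, List.mem_flatMap]
    simp only [List.mem_map, List.mem_filter, List.mem_range, ih, decide_eq_true_eq]
    constructor
    · rintro ⟨w, ⟨rfl, hd, hw⟩, x, ⟨hx, hxw⟩, rfl⟩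
      simpa using ⟨⟨hxw, hd⟩, hx, hw⟩
    · rintro ⟨hl, hd, hw⟩
      cases w with
      | nil => simp at hl
      | cons x w =>
        simp only [List.length_cons, Nat.add_right_cancel_iff, List.mem_cons, forall_eq_or_imp,
          List.nodup_cons] at hl hw hd
        exact ⟨w, ⟨hl, hd.2, hw.2⟩, x, ⟨hw.1, hd.1⟩, rfl⟩

theorem mem_distinctLists_iff_exists {w : List ℕ} :
    w ∈ distinctLists n k ↔ ∃ u, tupleCode k n u = w := by
  rw [mem_distinctLists]
  constructor
  · rintro ⟨rfl, hd, hw⟩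
    refine ⟨⟨fun i => ⟨w.get i, hw _ (List.get_mem w i)⟩, fun i j hij => ?_⟩, ?_⟩
    · exact List.nodup_iff_injective_get.1 hd (congrArg Fin.val hij)
    · exact List.ofFn_get w
  · rintro ⟨u, rfl⟩
    refine ⟨List.length_ofFn, ?_, ?_⟩
    · rw [tupleCode, List.nodup_ofFn]
      exact Fin.val_injective.comp u.injective
    · intro x hx
      obtain ⟨i, rfl⟩ := (List.mem_ofFn' _ _).1 hx
      exact (u i).2

variable {β : Fin k → ℕ}

theorem mem_veroneseCodes {w : List ℕ} :
    w ∈ veroneseCodes (List.ofFn β) n ↔ ∃ a, veroneseCode β n a = w := by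
  rw [veroneseCodes, List.mem_filter, mem_boundedLists, decide_eq_true_eq, listMax_ofFn,
    List.sum_ofFn]
  constructor
  · rintro ⟨⟨rfl, hw⟩, hs⟩
    refine ⟨⟨fun i => ⟨w.get i, hw _ (List.get_mem w i)⟩, ?_⟩, List.ofFn_get w⟩
    rw [← hs, ← List.sum_ofFn]
    exact congrArg List.sum (List.ofFn_get w)
  · rintro ⟨a, rfl⟩
    refine ⟨⟨List.length_ofFn, fun x hx => ?_⟩, ?_⟩
    · obtain ⟨i, rfl⟩ := (List.mem_ofFn' _ _).1 hx
      exact Nat.lt_succ_of_le (a.entries_le i)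
    · rw [veroneseCode, List.sum_ofFn, a.sum_entries]

theorem listCum_veroneseCode (a : VeroneseIndex β n) (j : ℕ) :
    listCum (veroneseCode β n a) j = a.cum j := by
  simp only [listCum, veroneseCode, getD_ofFn]
  rfl

theorem listUpper_veroneseCode (a b : VeroneseIndex β n) :
    listUpper (veroneseCode β n a) (veroneseCode β n b) = veroneseCode β n (upper a b) := by
  simp only [listUpper, listCum_veroneseCode]
  rw [map_range_eq_ofFn, veroneseCode, List.length_ofFn]
  rfl

theorem listLower_veroneseCode (a b : VeroneseIndex β n) :
    listLower (veroneseCode β n a) (veroneseCode β n b) = veroneseCode β n (lower a b) := by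
  simp only [listLower, listCum_veroneseCode]
  rw [map_range_eq_ofFn, veroneseCode, List.length_ofFn]
  rfl

theorem veroneseCode_injective : Function.Injective (veroneseCode β n) := fun _ _ h =>
  entries_injective (List.ofFn_injective h)

theorem tupleCode_injective : Function.Injective (tupleCode k n) := by
  intro u v h
  ext i
  exact congrFun (List.ofFn_injective h) i

theorem mem_groebnerCodes {c : MonomialCode × MonomialCode} :
    c ∈ groebnerCodes (List.ofFn β) n ↔ ∃ a b : VeroneseIndex β n,
      a ≠ upper a b ∧ a ≠ lower a b ∧ c = ([veroneseCode β n a, veroneseCode β n b],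
        [veroneseCode β n (upper a b), veroneseCode β n (lower a b)]) := by
  simp only [groebnerCodes, List.mem_flatMap, List.mem_map, List.mem_filter, mem_veroneseCodes,
    decide_eq_true_eq]
  constructor
  · rintro ⟨_, ⟨a, rfl⟩, _, ⟨⟨b, rfl⟩, hu, hl⟩, rfl⟩
    rw [listUpper_veroneseCode] at hu
    rw [listLower_veroneseCode] at hl
    refine ⟨a, b, fun h => hu (congrArg _ h), fun h => hl (congrArg _ h), ?_⟩
    rw [listUpper_veroneseCode, listLower_veroneseCode]
  · rintro ⟨a, b, hu, hl, rfl⟩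
    refine ⟨_, ⟨a, rfl⟩, _, ⟨⟨b, rfl⟩, ?_, ?_⟩, ?_⟩
    · rw [listUpper_veroneseCode]
      exact fun h => hu (veroneseCode_injective h)
    · rw [listLower_veroneseCode]
      exact fun h => hl (veroneseCode_injective h)
    · rw [listUpper_veroneseCode, listLower_veroneseCode]

theorem listExponent_tupleCode (u : Fin k ↪ Fin n) :
    listExponent (List.ofFn β) n (tupleCode k n u) = List.ofFn (exponentVector β u) := by
  rw [listExponent, map_range_eq_ofFn]
  congr 1
  funext j
  rw [List.length_ofFn, map_range_eq_ofFn, List.sum_ofFn]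
  refine Finset.sum_congr rfl fun i _ => ?_
  rw [tupleCode, getD_ofFn_val, getD_ofFn_val]
  simp only [Fin.val_inj]

theorem mem_linearCodes {c : QuotientCode × QuotientCode} :
    c ∈ linearCodes (List.ofFn β) n ↔ ∃ u v : Fin k ↪ Fin n, u ≠ v ∧
      exponentVector β u = exponentVector β v ∧
        c = (([tupleCode k n u], []), ([tupleCode k n v], [])) := by
  simp only [linearCodes, List.mem_flatMap, List.mem_map, List.mem_filter, List.length_ofFn,
    mem_distinctLists_iff_exists, decide_eq_true_eq]
  constructor
  · rintro ⟨_, ⟨u, rfl⟩, _, ⟨⟨v, rfl⟩, huv, he⟩, rfl⟩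
    rw [listExponent_tupleCode, listExponent_tupleCode] at he
    exact ⟨u, v, fun h => huv (congrArg _ h), List.ofFn_injective he, rfl⟩
  · rintro ⟨u, v, huv, he, rfl⟩
    refine ⟨_, ⟨u, rfl⟩, _, ⟨⟨v, rfl⟩, fun h => huv (tupleCode_injective h), ?_⟩, rfl⟩
    rw [listExponent_tupleCode, listExponent_tupleCode, he]

end CodesOfIndices

/-! ### Exponent vectors of coded monomials, and the coded Gröbner basis. -/

section CodesOfMonomials

open VeroneseIndex Finsupp

variable {ι : Type} [Finite ι] {code : ι → List ℕ}

theorem exponentOf_nil : exponentOf code [] = 0 := by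
  ext i
  simp [exponentOf]

theorem exponentOf_append (c d : MonomialCode) :
    exponentOf code (c ++ d) = exponentOf code c + exponentOf code d := by
  ext i
  simp [exponentOf]

theorem exponentOf_singleton (hcode : Function.Injective code) (i : ι) :
    exponentOf code [code i] = single i 1 := by
  classical
  ext j
  simp [exponentOf, List.count_singleton, single_apply, hcode.eq_iff]

theorem exponentOf_cons (w : List ℕ) (c : MonomialCode) :
    exponentOf code (w :: c) = exponentOf code [w] + exponentOf code c :=
  exponentOf_append [w] c

theorem exponentOf_pair (hcode : Function.Injective code) (i j : ι) :
    exponentOf code [code i, code j] = single i 1 + single j 1 := by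
  rw [exponentOf_cons, exponentOf_singleton hcode, exponentOf_singleton hcode]

theorem exponentOf_replicate (r : ℕ) (w : List ℕ) :
    exponentOf code (List.replicate r w) = r • exponentOf code [w] := by
  induction r with
  | zero => simp [exponentOf_nil]
  | succ r ih => rw [List.replicate_succ, exponentOf_cons, ih, succ_nsmul, add_comm]

theorem exponentOf_flatMap_range (r : ℕ) (f : ℕ → MonomialCode) :
    exponentOf code ((List.range r).flatMap f) = ∑ j ∈ Finset.range r, exponentOf code (f j) := by
  induction r with
  | zero => simp [exponentOf_nil]
  | succ r ih =>
    rw [List.range_succ, List.flatMap_append, exponentOf_append, ih, Finset.sum_range_succ]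
    simp

theorem decodeBinomials_groebnerCodes (K : Type*) [Field K] {k : ℕ} (β : Fin k → ℕ) (n : ℕ) :
    decodeBinomials K β n (groebnerCodes (List.ofFn β) n) = sortingBinomials K β n := by
  ext p
  simp only [decodeBinomials, sortingBinomials, Set.mem_ofPred_eq, mem_groebnerCodes]
  constructor
  · rintro ⟨_, ⟨a, b, hu, hl, rfl⟩, rfl⟩
    exact ⟨a, b, hu, hl, by
      rw [exponentOf_pair veroneseCode_injective, exponentOf_pair veroneseCode_injective]⟩
  · rintro ⟨a, b, hu, hl, rfl⟩
    exact ⟨_, ⟨a, b, hu, hl, rfl⟩, by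
      rw [exponentOf_pair veroneseCode_injective, exponentOf_pair veroneseCode_injective]⟩

theorem isQuadraticGroebnerCode_groebnerCodes {k : ℕ} {β : Fin k → ℕ} (hβ : ∑ i, β i ≠ 0)
    (n : ℕ) : IsQuadraticGroebnerCode.{u} β n (groebnerCodes (List.ofFn β) n) := by
  constructor
  · intro c hc
    obtain ⟨a, b, -, -, rfl⟩ := mem_groebnerCodes.1 hc
    refine ⟨?_, ?_, rfl, rfl⟩ <;>
    · intro w hw
      simp only [List.mem_cons, List.not_mem_nil, or_false] at hw
      rcases hw with rfl | rfl <;> exact ⟨_, rfl⟩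
  · refine ⟨sortingOrder β n, fun K _ => ?_⟩
    rw [decodeBinomials_groebnerCodes]
    exact isReducedGroebnerBasis_sortingBinomials hβ K

end CodesOfMonomials

end LaurentChain
namespace LaurentChain

/-! ### Coded monomial quotients and the explicit decomposition. -/

section QuotientCodes

open VeroneseIndex Finsupp

variable {k n : ℕ} {β : Fin k → ℕ}

/-- The exponent vector of the Laurent monomial with a given code. -/
noncomputable def quotientExponent (k n : ℕ) (c : QuotientCode) : (Fin k ↪ Fin n) →₀ ℤ :=
  natToInt _ (exponentOf (tupleCode k n) c.1) - natToInt _ (exponentOf (tupleCode k n) c.2)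

theorem decodeQuotient_eq (K : Type*) [Field K] (c : QuotientCode) :
    decodeQuotient K k n c = laurentMonomial K (quotientExponent k n c) := by
  rw [decodeQuotient, quotientExponent]
  congr 2 <;>
  · ext u
    rw [natToInt_apply, mapRange_apply]

theorem quotientExponent_tuple (u : Fin k ↪ Fin n) :
    quotientExponent k n ([tupleCode k n u], []) = single u 1 := by
  rw [quotientExponent, exponentOf_singleton tupleCode_injective, exponentOf_nil, map_zero,
    sub_zero, natToInt_single]
  rfl

theorem quotientExponent_monomialQuotientCode_pair (A : List ℕ) (b : List ℕ × List ℕ)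
    (x y : List ℕ) : quotientExponent k n (monomialQuotientCode A n b [x, y]) =
      quotientExponent k n (quotientCode A n b x) + quotientExponent k n (quotientCode A n b y) := by
  simp only [quotientExponent, monomialQuotientCode, List.flatMap_cons, List.flatMap_nil,
    List.append_nil, exponentOf_append, map_add]
  abel

/-- The integers coded by a pair of lists. -/
def bezoutVector (k : ℕ) (b : List ℕ × List ℕ) (i : Fin k) : ℤ :=
  (b.1.getD i 0 : ℤ) - (b.2.getD i 0 : ℤ)

theorem swap_val (x y z : Fin n) : ((Equiv.swap x y z : Fin n) : ℕ) = natSwap x y z := by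
  rw [Equiv.swap_apply_def, natSwap]
  simp only [Fin.ext_iff]
  split_ifs <;> rfl

theorem numeratorTuple_eq (h : k < n) (i : Fin k) (j : Fin n) :
    numeratorTuple k i j =
      tupleCode k n (permTuple h (Equiv.swap (Fin.castLE h.le i) j)) := by
  rw [numeratorTuple, map_range_eq_ofFn, tupleCode]
  congr 1
  funext t
  exact (swap_val (Fin.castLE h.le i) j (Fin.castLE h.le t)).symm

theorem denominatorTuple_eq (h : k < n) (i : Fin k) (j : Fin n) :
    denominatorTuple k n i j = tupleCode k n (permTuple h
      (Equiv.swap j ⟨n - 1, by omega⟩ * Equiv.swap (Fin.castLE h.le i) j)) := by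
  rw [denominatorTuple, map_range_eq_ofFn, tupleCode]
  congr 1
  funext t
  have h1 := swap_val (Fin.castLE h.le i) j (Fin.castLE h.le t)
  have h2 := swap_val j ⟨n - 1, by omega⟩ (Equiv.swap (Fin.castLE h.le i) j (Fin.castLE h.le t))
  rw [h1] at h2
  exact h2.symm

theorem range_eq_tupleCode (h : k < n) : List.range k = tupleCode k n (permTuple h 1) := by
  rw [← List.map_id (List.range k), map_range_eq_ofFn]
  rfl

theorem sum_range_pred_eq_sum_erase {M : Type*} [AddCommGroup M] (hn : 0 < n) (F : ℕ → M) :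
    ∑ j ∈ Finset.range (n - 1), F j =
      ∑ j ∈ Finset.univ.erase (⟨n - 1, by omega⟩ : Fin n), F j := by
  obtain ⟨m, rfl⟩ : ∃ m, n = m + 1 := ⟨n - 1, by omega⟩
  have h1 := Finset.sum_range_succ F m
  rw [Finset.sum_range, ← Finset.sum_erase_add _ _ (Finset.mem_univ (Fin.last m))] at h1
  exact (add_right_cancel h1).symm

theorem quotientExponent_decompositionSide (h : k < n) (hβ : ∑ i, β i ≠ 0)
    (b : List ℕ × List ℕ) (a : VeroneseIndex β n) :
    quotientExponent k n
      (List.range k :: decompositionSide (List.ofFn β) n b.1 b.2 (veroneseCode β n a),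
        decompositionSide (List.ofFn β) n b.2 b.1 (veroneseCode β n a)) =
      decomposition h β (bezoutVector k b) fun j => (a.entries j : ℤ) := by
  -- An index has the same entry sum as `β`, so `q = 1`; this is why the code starts with a single
  -- copy of the identity tuple.
  have hq : (∑ j, (a.entries j : ℤ)) / (∑ i, (β i : ℤ)) = 1 := by
    rw [← Nat.cast_sum, ← Nat.cast_sum, a.sum_entries]
    exact Int.ediv_self (by exact_mod_cast hβ)
  rw [quotientExponent, decomposition, hq]
  simp only [decompositionSide, List.length_ofFn]
  have h0 : exponentOf (tupleCode k n) [List.range k] = single (permTuple h 1) 1 := by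
    rw [range_eq_tupleCode h, exponentOf_singleton tupleCode_injective]
  rw [exponentOf_cons, map_add, h0, natToInt_single, one_smul, add_sub_assoc, Nat.cast_one]
  congr 1
  simp only [exponentOf_flatMap_range, map_sum, ← Finset.sum_sub_distrib]
  rw [sum_range_pred_eq_sum_erase (by omega)]
  refine Finset.sum_congr rfl fun j _ => ?_
  rw [Finset.sum_range]
  refine Finset.sum_congr rfl fun i _ => ?_
  rw [numeratorTuple_eq h, denominatorTuple_eq h]
  simp only [exponentOf_append, exponentOf_replicate, exponentOf_singleton tupleCode_injective,
    map_add, map_nsmul, natToInt_single, Nat.cast_one, veroneseCode, getD_ofFn_val]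
  have hα₀ : (if hj : (j : ℕ) < k then (β ⟨j, hj⟩ : ℤ) else 0) =
      ((List.ofFn β).getD j 0 : ℤ) := by
    rw [getD_ofFn]
    split_ifs <;> rfl
  rw [hα₀, bezoutVector]
  -- Interchanging the two parts of `b = p - q` between numerator and denominator leaves the
  -- exponent `(a p + A q) - (a q + A p) = (a - A)(p - q)` on the first tuple and its negative on
  -- the second.
  simp only [← natCast_zsmul]
  push_cast
  module

theorem mem_preimages {u : List ℕ} {a : VeroneseIndex β n} :
    u ∈ preimages (List.ofFn β) n (veroneseCode β n a) ↔
      ∃ v : Fin k ↪ Fin n, exponentVector β v = a.entries ∧ tupleCode k n v = u := by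
  rw [preimages, List.mem_filter, List.length_ofFn, mem_distinctLists_iff_exists,
    decide_eq_true_eq]
  constructor
  · rintro ⟨⟨v, rfl⟩, h⟩
    rw [listExponent_tupleCode] at h
    exact ⟨v, List.ofFn_injective h, rfl⟩
  · rintro ⟨v, h, rfl⟩
    rw [listExponent_tupleCode, h]
    exact ⟨⟨v, rfl⟩, rfl⟩

/-- The exponent vector of the monomial quotient which replaces an indeterminate. -/
noncomputable def replacementExponent (β : Fin k → ℕ) (n : ℕ) (b : List ℕ × List ℕ)
    (a : VeroneseIndex β n) : (Fin k ↪ Fin n) →₀ ℤ :=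
  quotientExponent k n (quotientCode (List.ofFn β) n b (veroneseCode β n a))

theorem quotientCode_cases (b : List ℕ × List ℕ) (a : VeroneseIndex β n) :
    (∃ u : Fin k ↪ Fin n, exponentVector β u = a.entries ∧
      quotientCode (List.ofFn β) n b (veroneseCode β n a) = ([tupleCode k n u], [])) ∨
    ((∀ u : Fin k ↪ Fin n, exponentVector β u ≠ a.entries) ∧
      quotientCode (List.ofFn β) n b (veroneseCode β n a) =
        (List.range k :: decompositionSide (List.ofFn β) n b.1 b.2 (veroneseCode β n a),
          decompositionSide (List.ofFn β) n b.2 b.1 (veroneseCode β n a))) := by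
  rw [quotientCode, List.length_ofFn]
  split_ifs with h0
  · right
    refine ⟨fun u hu => ?_, rfl⟩
    have : tupleCode k n u ∈ preimages (List.ofFn β) n (veroneseCode β n a) :=
      mem_preimages.2 ⟨u, hu, rfl⟩
    rw [h0] at this
    simp at this
  · left
    obtain ⟨x, l, hl⟩ := List.exists_cons_of_ne_nil h0
    obtain ⟨v, hv, hvx⟩ := mem_preimages.1 (hl ▸ List.mem_cons_self (a := x) (l := l))
    exact ⟨v, hv, by rw [hl, hvx]; rfl⟩

theorem isReplacement_replacementExponent (h : k < n) (hβ : ∑ i, β i ≠ 0)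
    (b : List ℕ × List ℕ) :
    IsReplacement h β (bezoutVector k b) (replacementExponent β n b) := by
  intro a
  rcases quotientCode_cases b a with ⟨u, hu, hc⟩ | ⟨hu, hc⟩
  · exact Or.inl ⟨u, hu, by rw [replacementExponent, hc, quotientExponent_tuple]⟩
  · exact Or.inr ⟨hu, by
      rw [replacementExponent, hc, quotientExponent_decompositionSide h hβ]⟩

theorem isMonomialCode_decompositionSide (h : k < n) (p q a : List ℕ) :
    IsMonomialCode (tupleCode k n) (decompositionSide (List.ofFn β) n p q a) := by
  intro w hw
  simp only [decompositionSide, List.length_ofFn, List.mem_flatMap, List.mem_range,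
    List.mem_append] at hw
  obtain ⟨j, hj, i, hi, hw | hw⟩ := hw
  · rw [List.eq_of_mem_replicate hw]
    exact ⟨_, (numeratorTuple_eq h ⟨i, hi⟩ ⟨j, by omega⟩).symm⟩
  · rw [List.eq_of_mem_replicate hw]
    exact ⟨_, (denominatorTuple_eq h ⟨i, hi⟩ ⟨j, by omega⟩).symm⟩

theorem isMonomialCode_quotientCode (h : k < n) (b : List ℕ × List ℕ) (a : VeroneseIndex β n) :
    IsMonomialCode (tupleCode k n) (quotientCode (List.ofFn β) n b (veroneseCode β n a)).1 ∧
      IsMonomialCode (tupleCode k n) (quotientCode (List.ofFn β) n b (veroneseCode β n a)).2 := by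
  rcases quotientCode_cases b a with ⟨u, hu, hc⟩ | ⟨hu, hc⟩
  · rw [hc]
    refine ⟨fun w hw => ⟨u, (List.mem_singleton.1 hw).symm⟩, fun w hw => by simp at hw⟩
  · rw [hc]
    refine ⟨fun w hw => ?_, isMonomialCode_decompositionSide h _ _ _⟩
    rcases List.mem_cons.1 hw with rfl | hw
    · exact ⟨_, (range_eq_tupleCode h).symm⟩
    · exact isMonomialCode_decompositionSide h _ _ _ w hw

theorem isMonomialCode_monomialQuotientCode_pair (h : k < n) (b : List ℕ × List ℕ)
    (x y : VeroneseIndex β n) :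
    IsMonomialCode (tupleCode k n) (monomialQuotientCode (List.ofFn β) n b
      [veroneseCode β n x, veroneseCode β n y]).1 ∧
    IsMonomialCode (tupleCode k n) (monomialQuotientCode (List.ofFn β) n b
      [veroneseCode β n x, veroneseCode β n y]).2 := by
  have hx := isMonomialCode_quotientCode h b x
  have hy := isMonomialCode_quotientCode h b y
  simp only [monomialQuotientCode, List.flatMap_cons, List.flatMap_nil, List.append_nil]
  constructor
  · intro w hw
    exact (List.mem_append.1 hw).elim (hx.1 w) (hy.1 w)
  · intro w hw
    exact (List.mem_append.1 hw).elim (hx.2 w) (hy.2 w)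

theorem replace_monomial_pair (K : Type*) [Field K]
    (μ : VeroneseIndex β n → ((Fin k ↪ Fin n) →₀ ℤ)) (x y : VeroneseIndex β n) :
    replace K μ (MvPolynomial.monomial (single x 1 + single y 1) 1) =
      laurentMonomial K (μ x + μ y) := by
  rw [replace, aeval_laurentMonomial_monomial, one_smul]
  simp

theorem decodeLaurentBinomials_generatorCodes (K : Type*) [Field K] (b : List ℕ × List ℕ) :
    decodeLaurentBinomials K k n (generatorCodes (List.ofFn β) n b) =
      replace K (replacementExponent β n b) '' sortingBinomials K β n ∪
        linearBinomials K β n := by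
  ext p
  simp only [decodeLaurentBinomials, Set.mem_ofPred_eq, generatorCodes, List.mem_append,
    List.mem_map, mem_groebnerCodes, mem_linearCodes, decodeQuotient_eq, Set.mem_union,
    Set.mem_image, linearBinomials]
  constructor
  · rintro ⟨_, ⟨_, ⟨x, y, hu, hl, rfl⟩, rfl⟩ | ⟨u, v, huv, he, rfl⟩, rfl⟩
    · refine Or.inl ⟨_, ⟨x, y, hu, hl, rfl⟩, ?_⟩
      rw [map_sub, replace_monomial_pair, replace_monomial_pair,
        quotientExponent_monomialQuotientCode_pair, quotientExponent_monomialQuotientCode_pair]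
      rfl
    · refine Or.inr ⟨u, v, huv, he, ?_⟩
      rw [quotientExponent_tuple, quotientExponent_tuple]
  · rintro (⟨_, ⟨x, y, hu, hl, rfl⟩, rfl⟩ | ⟨u, v, huv, he, rfl⟩)
    · refine ⟨_, Or.inl ⟨_, ⟨x, y, hu, hl, rfl⟩, rfl⟩, ?_⟩
      rw [map_sub, replace_monomial_pair, replace_monomial_pair,
        quotientExponent_monomialQuotientCode_pair, quotientExponent_monomialQuotientCode_pair]
      rfl
    · refine ⟨_, Or.inr ⟨u, v, huv, he, rfl⟩, ?_⟩
      rw [quotientExponent_tuple, quotientExponent_tuple]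

theorem isReplacementCode_generatorCodes (h : k < n) (hβ : ∑ i, β i ≠ 0)
    {b : List ℕ × List ℕ} (hb : ∑ i, bezoutVector k b i * (β i : ℤ) = 1) :
    IsReplacementCode.{u} h β (groebnerCodes (List.ofFn β) n)
      (generatorCodes (List.ofFn β) n b) := by
  constructor
  · intro c hc e he
    simp only [List.mem_cons, List.not_mem_nil, or_false] at he
    rw [generatorCodes, List.mem_append, List.mem_map, mem_linearCodes] at hc
    rcases hc with ⟨c, hc, rfl⟩ | ⟨u, v, -, -, rfl⟩
    · obtain ⟨x, y, -, -, rfl⟩ := mem_groebnerCodes.1 hc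
      have h1 := isMonomialCode_monomialQuotientCode_pair h b x y
      have h2 := isMonomialCode_monomialQuotientCode_pair h b (upper x y) (lower x y)
      rcases he with rfl | rfl | rfl | rfl
      exacts [h1.1, h1.2, h2.1, h2.2]
    · rcases he with rfl | rfl | rfl | rfl <;> intro w hw
      · exact ⟨u, (List.mem_singleton.1 hw).symm⟩
      · simp at hw
      · exact ⟨v, (List.mem_singleton.1 hw).symm⟩
      · simp at hw
  · refine ⟨bezoutVector k b, replacementExponent β n b, hb,
      isReplacement_replacementExponent h hβ b, fun K _ => ?_⟩
    rw [decodeBinomials_groebnerCodes, decodeLaurentBinomials_generatorCodes]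

theorem exponentVector_permTuple_one (h : k < n) (j : Fin n) :
    (exponentVector β (permTuple h 1) j : ℤ) =
      if hj : (j : ℕ) < k then (β ⟨j, hj⟩ : ℤ) else 0 := by
  split_ifs with hj
  · have : permTuple h 1 ⟨j, hj⟩ = j := rfl
    conv_lhs => rw [← this, exponentVector_apply_self]
  · rw [exponentVector_of_notMem, Nat.cast_zero]
    rintro i rfl
    exact hj i.2

/-- The last position lies outside the first `k`, so the base vector vanishes there, and each factor
contributes a multiple of `e_j - e_last`. Bézout makes the total coefficient of `e_j - e_last` equal
to `γ j` minus the base entry; equality of sums fixes the last coordinate. -/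
theorem tupleExponent_decomposition (h : k < n) {b : Fin k → ℤ}
    (hb : ∑ i, b i * (β i : ℤ) = 1) (hβ : ∑ i, β i ≠ 0) {γ : Fin n → ℤ}
    (hγ : ∑ j, γ j = ∑ i, (β i : ℤ)) : tupleExponent β n (decomposition h β b γ) = γ := by
  have hq : (∑ j, γ j) / (∑ i, (β i : ℤ)) = 1 := by
    rw [hγ]
    exact Int.ediv_self (by exact_mod_cast hβ)
  set last : Fin n := ⟨n - 1, by omega⟩ with hlast
  set u₀ : Fin k ↪ Fin n := permTuple h 1 with hu₀
  have hl : exponentVector β u₀ last = 0 := by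
    apply exponentVector_of_notMem
    intro i hi
    have h1 := congrArg Fin.val hi
    have h2 : ((u₀ i : Fin n) : ℕ) = i := rfl
    have h3 : (last : ℕ) = n - 1 := rfl
    omega
  rw [decomposition, hq]
  simp only [one_smul, one_mul, map_add, map_sum, map_smul, ← exponentVector_permTuple_one h]
  have hterm : ∀ j ∈ Finset.univ.erase last,
      ∑ i, ((γ j - (exponentVector β u₀ j : ℤ)) * b i) • tupleExponent β n
        (single (permTuple h (Equiv.swap (Fin.castLE h.le i) j)) 1 -
          single (permTuple h (Equiv.swap j last * Equiv.swap (Fin.castLE h.le i) j)) 1) =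
      (γ j - (exponentVector β u₀ j : ℤ)) • (Pi.single j 1 - Pi.single last 1) := by
    intro j hj
    have h1 : ∀ i : Fin k, tupleExponent β n
        (single (permTuple h (Equiv.swap (Fin.castLE h.le i) j)) 1 -
          single (permTuple h (Equiv.swap j last * Equiv.swap (Fin.castLE h.le i) j)) 1) =
        (β i : ℤ) • (Pi.single j 1 - Pi.single last 1) := by
      intro i
      refine tupleExponent_swap_sub_swap u₀ hl i (fun hi => ?_) (Finset.ne_of_mem_erase hj)
      have h1 := congrArg Fin.val hi
      have h2 : ((u₀ i : Fin n) : ℕ) = i := rfl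
      have h3 : (last : ℕ) = n - 1 := rfl
      omega
    simp only [h1, smul_smul]
    rw [← Finset.sum_smul]
    congr 1
    simp only [mul_assoc]
    rw [← Finset.mul_sum, hb, mul_one]
  rw [Finset.sum_congr rfl hterm, Finset.sum_erase _ (by simp), sum_smul_single_sub_single]
  · funext j
    simp [tupleExponent_single, hu₀]
  · rw [Finset.sum_sub_distrib, hγ, sub_eq_zero]
    exact_mod_cast (sum_exponentVector β u₀).symm

end QuotientCodes

/-! ### The replaced Gröbner basis generates the Laurent chain. -/

section Generation

open VeroneseIndex Finsupp

variable {k n : ℕ} {α : Fin k → ℕ}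

theorem IsReplacement.tupleExponent_eq {β : Fin k → ℕ} {h : k < n} {b : Fin k → ℤ}
    {μ : VeroneseIndex β n → ((Fin k ↪ Fin n) →₀ ℤ)} (hμ : IsReplacement h β b μ)
    (hb : ∑ i, b i * (β i : ℤ) = 1) (hβ : ∑ i, β i ≠ 0) (a : VeroneseIndex β n) :
    tupleExponent β n (μ a) = fun j => (a.entries j : ℤ) := by
  rcases hμ a with ⟨u, hu, h1⟩ | ⟨-, h1⟩
  · rw [h1]
    funext j
    rw [tupleExponent_single, one_mul, hu]
  · rw [h1]
    exact tupleExponent_decomposition h hb hβ (by exact_mod_cast a.sum_entries)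

/-- The replacement `μ` itself serves as the lift in `mem_of_tupleExponent_eq_zero`: replaced
sorting relations cover the first hypothesis, linear binomials the second. -/
theorem generatesLaurentChain_of_isReplacement {K : Type*} [Field K] (hα : α ≠ 0)
    {h : k < n} (hn : 2 * ∑ i, primitivePart α i ≤ n) {b : Fin k → ℤ}
    (hb : ∑ i, b i * (primitivePart α i : ℤ) = 1)
    {μ : VeroneseIndex (primitivePart α) n → ((Fin k ↪ Fin n) →₀ ℤ)}
    (hμ : IsReplacement h (primitivePart α) b μ) :
    GeneratesLaurentChain (MvPolynomial.monomial (equivFunOnFinite.symm α) (1 : K)) n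
      (replace K μ '' sortingBinomials K (primitivePart α) n ∪
        linearBinomials K (primitivePart α) n) := by
  have hβ := sum_primitivePart_ne_zero hα
  apply generatesLaurentChain_of_ker_le hα hb h hn
  · rintro _ (⟨_, ⟨x, y, -, -, rfl⟩, rfl⟩ | ⟨u, v, -, he, rfl⟩)
    · refine ⟨μ x + μ y, μ (upper x y) + μ (lower x y), ?_, ?_⟩
      · rw [map_sub, replace_monomial_pair, replace_monomial_pair]
      · simp only [map_add, hμ.tupleExponent_eq hb hβ]
        funext j
        simp only [Pi.add_apply]
        exact_mod_cast (entries_upper_add_lower x y j).symm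
    · refine ⟨_, _, rfl, ?_⟩
      funext j
      rw [tupleExponent_single, tupleExponent_single, he]
  · intro e he
    refine mem_of_tupleExponent_eq_zero hβ μ _ ?_ ?_ he
    · intro x y hu hl
      rw [← sub_mem_iff_mem_unitLattice]
      refine Ideal.subset_span (Or.inl ⟨_, ⟨x, y, hu, hl, rfl⟩, ?_⟩)
      rw [map_sub, replace_monomial_pair, replace_monomial_pair]
    · intro u
      -- The index of `u` is replaced by some `x_v` with the same image, possibly with `v ≠ u`; the
      -- linear binomial identifies the two.
      rcases hμ (tupleIndex _ u) with ⟨v, hv, h1⟩ | ⟨h1, -⟩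
      · rw [h1]
        by_cases huv : u = v
        · rw [huv, sub_self]
          exact AddSubgroup.zero_mem _
        · rw [← sub_mem_iff_mem_unitLattice]
          exact Ideal.subset_span (Or.inr ⟨u, v, huv, hv.symm, rfl⟩)
      · exact absurd rfl (h1 u)

end Generation

/-! ### Search for Bézout coefficients. -/

section Bezout

variable {k : ℕ}

theorem listDot_ofFn (β : Fin k → ℕ) (p : List ℕ) :
    listDot (List.ofFn β) p = ∑ i : Fin k, p.getD i 0 * β i := by
  rw [listDot, map_range_eq_ofFn, List.sum_ofFn]
  exact Fintype.sum_equiv (finCongr List.length_ofFn) _ _ fun i => by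
    rw [getD_ofFn, dif_pos (by simpa using i.2)]
    rfl

/-- The search must end on every list, including lists of zeros, which the test accepts through its
first alternative. Otherwise the positive and negative parts of integer coefficients give a pair of
lists that passes. -/
theorem exists_bezoutTest (l : List ℕ) : ∃ i b, b ∈ bezoutTest l i := by
  suffices ∃ b : List ℕ × List ℕ, listGcd l = 0 ∨
      listDot (listPrimitivePart l) b.1 = listDot (listPrimitivePart l) b.2 + 1 by
    obtain ⟨b, hb⟩ := this
    exact ⟨Encodable.encode b, b, by
      rw [bezoutTest, Encodable.encodek, Option.bind_some, if_pos hb]; rfl⟩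
  by_cases hl : l.get = 0
  · refine ⟨([], []), Or.inl ?_⟩
    have : l.sum = 0 := by
      rw [← List.ofFn_get l, hl, List.sum_ofFn]
      simp
    rw [listGcd, this]
    rfl
  · obtain ⟨b, hb⟩ := exists_sum_mul_primitivePart_eq_one hl
    -- Splitting into positive and negative parts turns the integer relation into one between
    -- natural numbers.
    refine ⟨(List.ofFn fun i => (b i).toNat, List.ofFn fun i => (-b i).toNat), Or.inr ?_⟩
    have h1 := listPrimitivePart_ofFn hl
    rw [List.ofFn_get] at h1
    rw [h1, listDot_ofFn, listDot_ofFn]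
    simp only [getD_ofFn_val]
    zify
    rw [← hb, ← Finset.sum_add_distrib]
    refine Finset.sum_congr rfl fun i _ => ?_
    rw [← add_mul]
    congr 1
    omega

/-- Coefficients of a Bézout relation of the primitive part, found by an unbounded search. -/
def bezoutSearch (l : List ℕ) : List ℕ × List ℕ :=
  (Nat.rfindOpt (bezoutTest l)).get (Nat.rfindOpt_dom.2 (exists_bezoutTest l))

theorem computable_bezoutSearch : Computable bezoutSearch :=
  (Partrec.rfindOpt primrec_bezoutTest.to_comp).of_eq fun _ => (Part.some_get _).symm

theorem sum_bezoutSearch {α : Fin k → ℕ} (hα : α ≠ 0) :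
    ∑ i, bezoutVector k (bezoutSearch (List.ofFn α)) i * (primitivePart α i : ℤ) = 1 := by
  obtain ⟨i, hi⟩ := Nat.rfindOpt_spec (Part.get_mem (Nat.rfindOpt_dom.2
    (exists_bezoutTest (List.ofFn α))))
  change bezoutSearch (List.ofFn α) ∈ _ at hi
  rw [bezoutTest, Option.mem_def, Option.bind_eq_some_iff] at hi
  obtain ⟨b, -, hb⟩ := hi
  split_ifs at hb with h
  rw [Option.some_inj] at hb
  subst hb
  rw [listGcd_ofFn hα, or_iff_right (gcd_ne_zero hα), listPrimitivePart_ofFn hα, listDot_ofFn,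
    listDot_ofFn] at h
  zify at h
  simp only [bezoutVector, sub_mul, Finset.sum_sub_distrib]
  rw [h]
  ring

end Bezout

/-! ### The two algorithms and the main theorem. -/

section Algorithm

/-- The code of the reduced Gröbner basis. -/
def groebnerAlgorithm (l : List ℕ) : List (MonomialCode × MonomialCode) :=
  groebnerCodes (listPrimitivePart l) (listBound (listPrimitivePart l))

/-- The code of the generating set of the Laurent chain. -/
def generatorAlgorithm (l : List ℕ) : List (QuotientCode × QuotientCode) :=
  generatorCodes (listPrimitivePart l) (listBound (listPrimitivePart l)) (bezoutSearch l)

theorem computable_groebnerAlgorithm : Computable groebnerAlgorithm :=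
  (primrec_groebnerCodes primrec_listPrimitivePart
    (primrec_listBound.comp primrec_listPrimitivePart)).to_comp

theorem computable_generatorAlgorithm : Computable generatorAlgorithm := by
  have h : Primrec fun x : List ℕ × (List ℕ × List ℕ) => generatorCodes
      (listPrimitivePart x.1) (listBound (listPrimitivePart x.1)) x.2 :=
    primrec_generatorCodes (primrec_listPrimitivePart.comp .fst)
      ((primrec_listBound.comp primrec_listPrimitivePart).comp .fst) .snd
  have h2 : Computable fun l => (l, bezoutSearch l) := Computable.id.pair computable_bezoutSearch
  exact (h.to_comp.comp h2).of_eq fun l => by rw [generatorAlgorithm]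

end Algorithm

end LaurentChain

theorem mainTheorem3 :
    ∃ (groebner : List ℕ → List (LaurentChain.MonomialCode × LaurentChain.MonomialCode))
      (generators : List ℕ → List (LaurentChain.QuotientCode × LaurentChain.QuotientCode)),
      Computable groebner ∧ Computable generators ∧
      ∀ (k : ℕ) (α : Fin k → ℕ), α ≠ 0 →
        LaurentChain.IsQuadraticGroebnerCode.{u} (LaurentChain.primitivePart α)
          (LaurentChain.bound α) (groebner (List.ofFn α)) ∧
        LaurentChain.IsReplacementCode.{u} (LaurentChain.lt_bound α) (LaurentChain.primitivePart α)
          (groebner (List.ofFn α)) (generators (List.ofFn α)) ∧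
        ∀ (K : Type u) [Field K],
          LaurentChain.GeneratesLaurentChain
            (MvPolynomial.monomial (Finsupp.equivFunOnFinite.symm α) (1 : K))
            (LaurentChain.bound α)
            (LaurentChain.decodeLaurentBinomials K k (LaurentChain.bound α)
              (generators (List.ofFn α))) := by
  refine ⟨LaurentChain.groebnerAlgorithm, LaurentChain.generatorAlgorithm,
    LaurentChain.computable_groebnerAlgorithm, LaurentChain.computable_generatorAlgorithm,
    fun k α hα => ?_⟩
  have hβ := LaurentChain.sum_primitivePart_ne_zero hα
  have hb := LaurentChain.sum_bezoutSearch hα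
  rw [LaurentChain.groebnerAlgorithm, LaurentChain.generatorAlgorithm,
    LaurentChain.listPrimitivePart_ofFn hα, LaurentChain.listBound_ofFn_primitivePart]
  refine ⟨LaurentChain.isQuadraticGroebnerCode_groebnerCodes hβ _,
    LaurentChain.isReplacementCode_generatorCodes (LaurentChain.lt_bound α) hβ hb,
    fun K _ => ?_⟩
  rw [LaurentChain.decodeLaurentBinomials_generatorCodes]
  exact LaurentChain.generatesLaurentChain_of_isReplacement hα (le_max_left _ _) hb
    (LaurentChain.isReplacement_replacementExponent (LaurentChain.lt_bound α) hβ _)
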